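/- Let $\mathbb U$ (the universe) be a Polish space with its Borel $\sigma$-algebra. A schema $\tau$ consists of finitely many relation symbols $R$, each with an arity $k_R\in\mathbb N$ and Borel attribute domains $\mathrm{dom}_{R,1},\dots,\mathrm{dom}_{R,k_R}\subseteq\mathbb U$. The set $\mathbb F_\tau=\bigsqcup_R\prod_{i}\mathrm{dom}_{R,i}$ of facts carries the disjoint-union/product $\sigma$-algebra. Let $\mathbb{DB}_\tau$ be the set of all finite bags of facts (bag instances), with the counting $\sigma$-algebra $\mathfrak C_\tau$, which is generated by the events $\#(F,n)$ that exactly $n$ facts of the bag, counted with multiplicity, lie in $F$ ($F\subseteq\mathbb F_\tau$ measurable, $n\in\mathbb N$). A standard PDB of schema $\tau$ is a probability measure on $(\mathbb{DB}_\tau,\mathfrak C_\tau)$. A view is a map $V:\mathbb{DB}_\tau\to\mathbb{DB}_{\tau'}$; a query is a view whose output schema $\tau'$ has a single relation. Aggregate functions are measurable maps from finite bags of tuples over $\mathbb U$ (with the counting $\sigma$-algebra) to $\mathbb U$; this includes COUNT, SUM, AVG, MIN and MAX on numerical values. Let $V:\mathbb{DB}_\tau\to\mathbb{DB}_{\tau'}$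 be a view that is expressible in one of the following languages (in 1 and 2 and in 4, each output relation is given by its own expression, query or formula): 1. relational algebra with bag semantics and aggregation: relation symbols, constant tuples, selection by Borel predicates, projection, product, additive union, maximum union, intersection, difference, deduplication, aggregation of a whole bag, and grouping with aggregation; 2. relational calculus with aggregation: queries $\{(s_1(\bar x),\dots,s_k(\bar x))\mid\varphi(\bar x)\}$ with first-order $\varphi$ built from relation atoms, equality and Borel built-in predicates, where terms are variables, constants or aggregate terms (an aggregate function applied to the bag of all $\bar s(\bar x,\bar z)$, with $\bar z$ ranging over the tuples satisfying $\psi(\bar x,\bar z)$); 3. Datalog (finitely many rules without negation, all head variables occurring in the body; the rules are applied, starting from empty intensional relations, until no new fact is generated), or inflationary Datalog with negation (negated atoms are allowed in bodies; in each stage all facts generated by the rules are added); the output consists of some of the intensional relations; 4. least fixed-point logic: first-order logic as in 2, without aggregation, closed under $[\mathrm{LFP}_{X,\bar y}\,\varphi](\bar t)$ for $\varphi$ positive in $X$. In 2–4 an atom holds if the fact has multiplicity at least one, the output is a set (all multiplicities are $0$ or $1$), and variables range over the active domain, that is, the values occurring in the instance together with the constants of the query (for Datalog, over all of $\mathbb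 U$, which makes no difference). Then $V$ is measurable with respect to $\mathfrak C_\tau$ and $\mathfrak C_{\tau'}$. Hence for every standard PDB $P$ of schema $\tau$ there is exactly one standard PDB $P'$ of schema $\tau'$ with $P'(C')=P(V^{-1}(C'))$ for all $C'\in\mathfrak C_{\tau'}$, namely the push-forward of $P$ along $V$. -/

import Mathlib

open MeasureTheory

universe u

namespace StandardPDB

/-! ### Finite bags and the counting σ-algebra -/

section Bags

variable {X : Type u}

open Classical in
/-- The number of elements of `F` in the finite bag `D`, counted with multiplicities. -/
noncomputable def countIn (F : Set X) (D : Multiset X) : ℕ :=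
  D.countP (fun x => x ∈ F)

/-- The counting event `#(F, n)`: exactly `n` elements of the bag lie in `F`. -/
def countEvent (F : Set X) (n : ℕ) : Set (Multiset X) :=
  {D | countIn F D = n}

/-- The counting σ-algebra on finite bags. -/
instance countingSigmaAlgebra [MeasurableSpace X] : MeasurableSpace (Multiset X) :=
  MeasurableSpace.generateFrom
    {C | ∃ (F : Set X) (n : ℕ), MeasurableSet F ∧ C = countEvent F n}

end Bags

/-! ### Schemas, facts, instances, views -/

section Databases

variable {U : Type u} [MeasurableSpace U]

/-- A database schema over the universe `U`: finitely many relation symbols, each with an arity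
and a (Borel) attribute domain for each of its attributes. -/
structure Schema (U : Type u) [MeasurableSpace U] where
  Rel : Type
  finite_rel : Finite Rel
  arity : Rel → ℕ
  dom : (r : Rel) → Fin (arity r) → Set U
  measurableSet_dom : ∀ r i, MeasurableSet (dom r i)

/-- Facts `R(a₁, …, a_k)` with `a_i` in the domain of the `i`-th attribute of `R`.  The σ-algebra is
Mathlib's one on disjoint unions of finite products of subspaces of `U`. -/
abbrev Fact (τ : Schema U) : Type u :=
  Σ r : τ.Rel, (i : Fin (τ.arity r)) → τ.dom r i

/-- Bag instances, i.e. finite bags of facts, with the counting σ-algebra. -/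
abbrev Instance (τ : Schema U) : Type u := Multiset (Fact τ)

/-- A view; a query is the case where `τ'` has exactly one relation symbol. -/
abbrev View (τ τ' : Schema U) : Type u := Instance τ → Instance τ'

/-- A standard probabilistic database: a probability measure on the measurable space of all
bag instances. -/
abbrev PDB (τ : Schema U) : Type u := ProbabilityMeasure (Instance τ)

open Classical in
/-- The bag of tuples that the instance `D` stores in the relation `r`. -/
noncomputable def relOf {τ : Schema U} (D : Instance τ) (r : τ.Rel) :
    Multiset (Fin (τ.arity r) → U) :=
  D.filterMap (fun f : Fact τ =>
    if h : f.1 = r then some (fun i => ((h ▸ f.2 : (i : Fin (τ.arity r)) → τ.dom r i) i : U))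
    else none)

open Classical in
/-- The active domain of an instance: all values that occur in its facts. -/
noncomputable def adom {τ : Schema U} (D : Instance τ) : Finset U :=
  (D.bind (fun f : Fact τ =>
    (Finset.univ : Finset (Fin (τ.arity f.1))).val.map (fun i => (f.2 i : U)))).toFinset

/-- The view `V` returns, for each output relation, exactly the given answers as a plain set. -/
def ComputesSets {τ τ' : Schema U} (V : View τ τ')
    (ans : Instance τ → (r : τ'.Rel) → Set (Fin (τ'.arity r) → U)) : Prop :=
  ∀ (D : Instance τ) (r : τ'.Rel),
    (relOf (V D) r).Nodup ∧ ∀ t, t ∈ relOf (V D) r ↔ t ∈ ans D r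

end Databases

/-! ### Aggregate functions -/

section Aggregates

variable {U : Type u} [MeasurableSpace U]

/-- An aggregate function on bags of `l`-tuples: a measurable map from bags to values. -/
structure Aggregate (U : Type u) [MeasurableSpace U] (l : ℕ) where
  toFun : Multiset (Fin l → U) → U
  measurable_toFun : Measurable toFun

theorem measurable_countIn {X : Type u} [MeasurableSpace X] {F : Set X} (hF : MeasurableSet F) :
    Measurable (countIn F) :=
  measurable_to_countable' fun n =>
    MeasurableSpace.measurableSet_generateFrom ⟨F, n, hF, rfl⟩

theorem measurable_card {X : Type u} [MeasurableSpace X] :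
    Measurable (fun D : Multiset X => D.card) := by
  have h := measurable_countIn (X := X) MeasurableSet.univ
  have e : countIn (Set.univ : Set X) = fun D => D.card := by
    funext D
    simp [countIn]
  rwa [e] at h

theorem measurable_map_sum {X : Type u} [MeasurableSpace X] {f : X → ℝ} (hf : Measurable f) :
    Measurable (fun D : Multiset X => (D.map f).sum) := by
  classical
  have hs : ∀ g : SimpleFunc X ℝ, Measurable (fun D : Multiset X => (D.map g).sum) := by
    intro g
    induction g using SimpleFunc.induction with
    | const c hF =>
      rename_i F
      have : (fun D : Multiset X => (D.map (SimpleFunc.piecewise F hF (SimpleFunc.const X c)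
          (SimpleFunc.const X 0))).sum) = fun D => (countIn F D : ℝ) * c := by
        funext D
        induction D using Multiset.induction_on with
        | empty => simp [countIn]
        | cons a D ih =>
          rw [Multiset.map_cons, Multiset.sum_cons, ih]
          by_cases ha : a ∈ F
          · simp [countIn, ha]; ring
          · simp [countIn, ha]
      rw [this]
      exact ((measurable_from_top (f := fun n : ℕ => (n : ℝ))).comp
        (measurable_countIn hF)).mul_const c
    | add _ hf hg =>
      simp only [SimpleFunc.coe_add, Pi.add_apply, Multiset.sum_map_add]
      exact hf.add hg
  obtain ⟨g, hg⟩ := hf.stronglyMeasurable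
  refine measurable_of_tendsto_metrizable (fun n => hs (g n)) ?_
  rw [tendsto_pi_nhds]
  intro D
  induction D using Multiset.induction_on with
  | empty => simp
  | cons a D ih => simpa using (hg a).add ih

theorem measurable_map_sSup {X : Type u} [MeasurableSpace X] {f : X → ℝ} (hf : Measurable f) :
    Measurable (fun D : Multiset X => sSup {y : ℝ | y ∈ D.map f}) := by
  refine measurable_of_Iic fun c => ?_
  have : (fun D : Multiset X => sSup {y : ℝ | y ∈ D.map f}) ⁻¹' Set.Iic c =
      {D | (D.card = 0 ∧ 0 ≤ c) ∨ (D.card ≠ 0 ∧ countIn (f ⁻¹' Set.Ioi c) D = 0)} := by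
    ext D
    rcases eq_or_ne D 0 with rfl | hD
    · simp
    · have hne : {y : ℝ | y ∈ D.map f}.Nonempty := by
        obtain ⟨a, ha⟩ := Multiset.exists_mem_of_ne_zero hD
        exact ⟨f a, Multiset.mem_map_of_mem f ha⟩
      have hfin : {y : ℝ | y ∈ D.map f}.Finite := by
        classical
        exact (D.map f).toFinset.finite_toSet.subset fun y hy => by simpa using hy
      rw [Set.mem_preimage, Set.mem_Iic, csSup_le_iff hfin.bddAbove hne]
      simp [hD, countIn, Multiset.countP_eq_zero]
  rw [this]
  have h0 := measurable_card (X := X) (measurableSet_singleton 0)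
  have h1 := measurable_countIn (hf measurableSet_Ioi) (measurableSet_singleton 0)
    (F := f ⁻¹' Set.Ioi c)
  exact (h0.inter (MeasurableSet.const _)).union (h0.compl.inter h1)

/-! The usual aggregate functions, on a universe whose elements are read as numbers through `num`
and into which numbers are written through `val`. -/

section Standard

variable (num : U → ℝ) (hnum : Measurable num) (val : ℝ → U) (hval : Measurable val)

/-- The number of entries. -/
def Aggregate.count (l : ℕ) : Aggregate U l where
  toFun b := val b.card
  measurable_toFun := hval.comp (measurable_from_top.comp measurable_card)

/-- The sum of the entries. -/
def Aggregate.sum : Aggregate U 1 where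
  toFun b := val (b.map fun t => num (t 0)).sum
  measurable_toFun := hval.comp (measurable_map_sum (hnum.comp (measurable_pi_apply 0)))

/-- The average of the entries (`0` for the empty bag). -/
noncomputable def Aggregate.avg : Aggregate U 1 where
  toFun b := val ((b.map fun t => num (t 0)).sum / b.card)
  measurable_toFun := hval.comp
    ((measurable_map_sum (hnum.comp (measurable_pi_apply 0))).div
      (measurable_from_top.comp measurable_card))

/-- The largest entry (`0` for the empty bag). -/
noncomputable def Aggregate.max : Aggregate U 1 where
  toFun b := val (sSup {y | y ∈ b.map fun t => num (t 0)})
  measurable_toFun := hval.comp (measurable_map_sSup (hnum.comp (measurable_pi_apply 0)))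

/-- The smallest entry (`0` for the empty bag). -/
noncomputable def Aggregate.min : Aggregate U 1 where
  toFun b := val (-sSup {y | y ∈ b.map fun t => -num (t 0)})
  measurable_toFun := hval.comp
    (measurable_map_sSup (hnum.comp (measurable_pi_apply 0)).neg).neg

end Standard

end Aggregates

/-! ### Bag relational algebra with aggregation -/

section Algebra

variable {U : Type u} [MeasurableSpace U]

/-- Expressions of the bag relational algebra with aggregation, indexed by the output arity. -/
inductive BagExpr (τ : Schema U) : ℕ → Type u
  | rel (r : τ.Rel) : BagExpr τ (τ.arity r)
  | single {k : ℕ} (t : Fin k → U) : BagExpr τ k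
  | select {k : ℕ} (B : Set (Fin k → U)) (hB : MeasurableSet B) (e : BagExpr τ k) : BagExpr τ k
  | project {k m : ℕ} (f : Fin m → Fin k) (e : BagExpr τ k) : BagExpr τ m
  | product {k m : ℕ} (e₁ : BagExpr τ k) (e₂ : BagExpr τ m) : BagExpr τ (k + m)
  | addUnion {k : ℕ} (e₁ e₂ : BagExpr τ k) : BagExpr τ k
  | maxUnion {k : ℕ} (e₁ e₂ : BagExpr τ k) : BagExpr τ k
  | inter {k : ℕ} (e₁ e₂ : BagExpr τ k) : BagExpr τ k
  | diff {k : ℕ} (e₁ e₂ : BagExpr τ k) : BagExpr τ k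
  | dedup {k : ℕ} (e : BagExpr τ k) : BagExpr τ k
  | aggregate {k l : ℕ} (Φ : Aggregate U l) (arg : Fin l → Fin k) (e : BagExpr τ k) : BagExpr τ 1
  | groupBy {k m l : ℕ} (key : Fin m → Fin k) (Φ : Aggregate U l) (arg : Fin l → Fin k)
      (e : BagExpr τ k) : BagExpr τ (m + 1)

open Classical in
/-- Bag semantics.  Projection keeps multiplicities (and `project` may also permute and repeat
columns), `diff` is truncated difference of multiplicities.  `aggregate` returns one row with the
aggregate of the whole bag; `groupBy` returns one row per group occurring in the bag, namely the
key followed by the aggregate of the group. -/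
noncomputable def BagExpr.eval {τ : Schema U} (D : Instance τ) :
    {k : ℕ} → BagExpr τ k → Multiset (Fin k → U)
  | _, .rel r => relOf D r
  | _, .single t => {t}
  | _, .select B _ e => (e.eval D).filter (fun t => t ∈ B)
  | _, .project f e => (e.eval D).map (fun t => t ∘ f)
  | _, .product e₁ e₂ => (e₁.eval D ×ˢ e₂.eval D).map (fun p => Fin.append p.1 p.2)
  | _, .addUnion e₁ e₂ => e₁.eval D + e₂.eval D
  | _, .maxUnion e₁ e₂ => e₁.eval D ∪ e₂.eval D
  | _, .inter e₁ e₂ => e₁.eval D ∩ e₂.eval D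
  | _, .diff e₁ e₂ => e₁.eval D - e₂.eval D
  | _, .dedup e => (e.eval D).dedup
  | _, .aggregate Φ arg e => {fun _ => Φ.toFun ((e.eval D).map (fun t => t ∘ arg))}
  | _, .groupBy key Φ arg e =>
      ((e.eval D).map (fun t => t ∘ key)).dedup.map (fun b =>
        Fin.snoc (α := fun _ => U) b
          (Φ.toFun (((e.eval D).filter (fun t => t ∘ key = b)).map (fun t => t ∘ arg))))

/-- `V` is expressible in the bag relational algebra with aggregation. -/
def AlgebraExpressible {τ τ' : Schema U} (V : View τ τ') : Prop :=
  ∃ E : (r : τ'.Rel) → BagExpr τ (τ'.arity r), ∀ D r, relOf (V D) r = (E r).eval D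

end Algebra

/-! ### Relational calculus with aggregation -/

section Calculus

variable {U : Type u} [MeasurableSpace U]

mutual

/-- Terms of the relational calculus with aggregation with free variables `x₀, …, x_{n-1}`.
`agg Φ s ψ` is `Φ` applied to the bag of all `s(x̄, z̄)`, where `z̄` ranges over the `m`-tuples that
satisfy `ψ(x̄, z̄)`. -/
inductive CalcTerm (τ : Schema U) : ℕ → Type u
  | var {n : ℕ} (i : Fin n) : CalcTerm τ n
  | const {n : ℕ} (c : U) : CalcTerm τ n
  | agg {n m l : ℕ} (Φ : Aggregate U l) (s : Fin l → CalcTerm τ (n + m))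
      (ψ : CalcFormula τ (n + m)) : CalcTerm τ n

/-- Formulas of the relational calculus with aggregation, with measurable built-in predicates. -/
inductive CalcFormula (τ : Schema U) : ℕ → Type u
  | rel {n : ℕ} (r : τ.Rel) (s : Fin (τ.arity r) → CalcTerm τ n) : CalcFormula τ n
  | eq {n : ℕ} (s₁ s₂ : CalcTerm τ n) : CalcFormula τ n
  | pred {n k : ℕ} (B : Set (Fin k → U)) (hB : MeasurableSet B) (s : Fin k → CalcTerm τ n) :
      CalcFormula τ n
  | not {n : ℕ} (φ : CalcFormula τ n) : CalcFormula τ n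
  | and {n : ℕ} (φ ψ : CalcFormula τ n) : CalcFormula τ n
  | or {n : ℕ} (φ ψ : CalcFormula τ n) : CalcFormula τ n
  | ex {n : ℕ} (φ : CalcFormula τ (n + 1)) : CalcFormula τ n
  | all {n : ℕ} (φ : CalcFormula τ (n + 1)) : CalcFormula τ n

end

open Classical in
mutual

/-- The constants that occur in a term. -/
noncomputable def CalcTerm.consts {τ : Schema U} : {n : ℕ} → CalcTerm τ n → Finset U
  | _, .var _ => ∅
  | _, .const c => {c}
  | _, .agg _ s ψ => (Finset.univ.biUnion fun i => (s i).consts) ∪ ψ.consts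

/-- The constants that occur in a formula. -/
noncomputable def CalcFormula.consts {τ : Schema U} : {n : ℕ} → CalcFormula τ n → Finset U
  | _, .rel _ s => Finset.univ.biUnion fun i => (s i).consts
  | _, .eq s₁ s₂ => s₁.consts ∪ s₂.consts
  | _, .pred _ _ s => Finset.univ.biUnion fun i => (s i).consts
  | _, .not φ => φ.consts
  | _, .and φ ψ => φ.consts ∪ ψ.consts
  | _, .or φ ψ => φ.consts ∪ ψ.consts
  | _, .ex φ => φ.consts
  | _, .all φ => φ.consts

end

open Classical in
mutual

/-- Value of a term on the instance `D`, bound variables ranging over the finite set `d`. -/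
noncomputable def CalcTerm.eval {τ : Schema U} (D : Instance τ) (d : Finset U) :
    {n : ℕ} → CalcTerm τ n → (Fin n → U) → U
  | _, .var i, v => v i
  | _, .const c, _ => c
  | _, .agg (m := m) Φ s ψ, v =>
      Φ.toFun
        (((Fintype.piFinset fun _ : Fin m => d).filter
          (fun z => Fin.append v z ∈ ψ.sat D d)).val.map
            (fun z i => (s i).eval D d (Fin.append v z)))

/-- The assignments that satisfy a formula on the instance `D`, bound variables ranging over the
finite set `d`. -/
noncomputable def CalcFormula.sat {τ : Schema U} (D : Instance τ) (d : Finset U) :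
    {n : ℕ} → CalcFormula τ n → Set (Fin n → U)
  | _, .rel r s => {v | (fun i => (s i).eval D d v) ∈ relOf D r}
  | _, .eq s₁ s₂ => {v | s₁.eval D d v = s₂.eval D d v}
  | _, .pred B _ s => {v | (fun i => (s i).eval D d v) ∈ B}
  | _, .not φ => {v | v ∉ φ.sat D d}
  | _, .and φ ψ => {v | v ∈ φ.sat D d ∧ v ∈ ψ.sat D d}
  | _, .or φ ψ => {v | v ∈ φ.sat D d ∨ v ∈ ψ.sat D d}
  | _, .ex φ => {v | ∃ a ∈ d, Fin.snoc (α := fun _ => U) v a ∈ φ.sat D d}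
  | _, .all φ => {v | ∀ a ∈ d, Fin.snoc (α := fun _ => U) v a ∈ φ.sat D d}

end

/-- A calculus query `{(s₁(x̄), …, s_k(x̄)) | φ(x̄)}`. -/
structure CalcQuery (τ : Schema U) (k : ℕ) where
  n : ℕ
  head : Fin k → CalcTerm τ n
  body : CalcFormula τ n

open Classical in
/-- The active domain of the query on `D`: the values in `D` and the constants of the query. -/
noncomputable def CalcQuery.activeDomain {τ : Schema U} {k : ℕ} (Q : CalcQuery τ k)
    (D : Instance τ) : Finset U :=
  adom D ∪ (Finset.univ.biUnion fun i => (Q.head i).consts) ∪ Q.body.consts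

/-- The answers to a calculus query under active-domain semantics. -/
def CalcQuery.answers {τ : Schema U} {k : ℕ} (Q : CalcQuery τ k) (D : Instance τ) :
    Set (Fin k → U) :=
  {t | ∃ v : Fin Q.n → U, (∀ i, v i ∈ Q.activeDomain D) ∧ v ∈ Q.body.sat D (Q.activeDomain D) ∧
    t = fun j => (Q.head j).eval D (Q.activeDomain D) v}

/-- `V` is expressible in the relational calculus with aggregation. -/
def CalculusExpressible {τ τ' : Schema U} (V : View τ τ') : Prop :=
  ∃ Q : (r : τ'.Rel) → CalcQuery τ (τ'.arity r), ComputesSets V (fun D r => (Q r).answers D)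

end Calculus

/-! ### Terms without aggregation -/

section Terms

variable {U : Type u}

/-- A variable among `x₀, …, x_{n-1}` or a constant. -/
inductive Term (U : Type u) (n : ℕ) : Type u
  | var (i : Fin n) : Term U n
  | const (c : U) : Term U n

def Term.eval {n : ℕ} (v : Fin n → U) : Term U n → U
  | .var i => v i
  | .const c => c

end Terms

/-! ### Datalog and inflationary Datalog with negation -/

section Datalog

variable {U : Type u} [MeasurableSpace U]

/-- An atom `S(t₁, …, t_k)` over the relation symbols `R` with arities `ar`. -/
structure Atom (U : Type u) {R : Type} (ar : R → ℕ) (n : ℕ) where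
  sym : R
  args : Fin (ar sym) → Term U n

/-- The arities of the intensional symbols: the output symbols and auxiliary symbols `A`. -/
abbrev idbArity (τ' : Schema U) {A : Type} (ar : A → ℕ) : τ'.Rel ⊕ A → ℕ :=
  Sum.elim τ'.arity ar

/-- The arities of all symbols that may occur in a rule body: extensional or intensional. -/
abbrev bodyArity (τ τ' : Schema U) {A : Type} (ar : A → ℕ) : τ.Rel ⊕ (τ'.Rel ⊕ A) → ℕ :=
  Sum.elim τ.arity (idbArity τ' ar)

/-- A rule in `n` variables; `pos` and `neg` list the positive and the negated body atoms. -/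
structure Rule (τ τ' : Schema U) {A : Type} (ar : A → ℕ) where
  n : ℕ
  head : Atom U (idbArity τ' ar) n
  pos : List (Atom U (bodyArity τ τ' ar) n)
  neg : List (Atom U (bodyArity τ τ' ar) n)

/-- A program: a finite list of rules. -/
abbrev Program (τ τ' : Schema U) {A : Type} (ar : A → ℕ) := List (Rule τ τ' ar)

/-- Interpretations of the intensional symbols, as sets of facts. -/
abbrev IdbState (τ' : Schema U) {A : Type} (ar : A → ℕ) : Type u :=
  Set (Σ s : τ'.Rel ⊕ A, (Fin (idbArity τ' ar s) → U))

/-- Truth of a body atom: extensional symbols are read in `D`, intensional ones in `J`. -/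
def Atom.Holds {τ τ' : Schema U} {A : Type} {ar : A → ℕ} {n : ℕ} (D : Instance τ)
    (J : IdbState τ' ar) (v : Fin n → U) : Atom U (bodyArity τ τ' ar) n → Prop
  | ⟨.inl r, s⟩ => (fun i => (s i).eval v) ∈ relOf D r
  | ⟨.inr p, s⟩ => (⟨p, fun i => (s i).eval v⟩ : Σ q, (Fin (idbArity τ' ar q) → U)) ∈ J

/-- The facts generated by one application of a rule of `P`, with variables valued in `d`. -/
def Program.consequences {τ τ' : Schema U} {A : Type} {ar : A → ℕ} (P : Program τ τ' ar)
    (d : Set U) (D : Instance τ) (J : IdbState τ' ar) : IdbState τ' ar :=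
  {f | ∃ ρ ∈ P, ∃ v : Fin ρ.n → U, (∀ i, v i ∈ d) ∧
    (∀ a ∈ ρ.pos, a.Holds D J v) ∧ (∀ a ∈ ρ.neg, ¬ a.Holds D J v) ∧
    f = ⟨ρ.head.sym, fun i => (ρ.head.args i).eval v⟩}

/-- The stages of the computation: start from empty intensional relations and repeatedly add all
facts that the rules generate. -/
def Program.stage {τ τ' : Schema U} {A : Type} {ar : A → ℕ} (P : Program τ τ' ar)
    (d : Set U) (D : Instance τ) : ℕ → IdbState τ' ar
  | 0 => ∅
  | j + 1 => P.stage d D j ∪ P.consequences d D (P.stage d D j)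

/-- The tuples that are eventually generated for the output relation `r`. -/
def Program.answers {τ τ' : Schema U} {A : Type} {ar : A → ℕ} (P : Program τ τ' ar)
    (d : Set U) (D : Instance τ) (r : τ'.Rel) : Set (Fin (τ'.arity r) → U) :=
  {t | ∃ j, (⟨Sum.inl r, t⟩ : Σ q, (Fin (idbArity τ' ar q) → U)) ∈ P.stage d D j}

/-- A Datalog program: no negation, and every head variable occurs in the body of its rule. -/
def Program.IsDatalog {τ τ' : Schema U} {A : Type} {ar : A → ℕ} (P : Program τ τ' ar) : Prop :=
  ∀ ρ ∈ P, ρ.neg = [] ∧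
    ∀ x : Fin ρ.n, (∃ i, ρ.head.args i = Term.var x) → ∃ a ∈ ρ.pos, ∃ i, a.args i = Term.var x

/-- The constants that occur in a program. -/
def Program.consts {τ τ' : Schema U} {A : Type} {ar : A → ℕ} (P : Program τ τ' ar) : Set U :=
  {c | ∃ ρ ∈ P, (∃ i, ρ.head.args i = Term.const c) ∨
    (∃ a ∈ ρ.pos, ∃ i, a.args i = Term.const c) ∨ (∃ a ∈ ρ.neg, ∃ i, a.args i = Term.const c)}

/-- `V` is expressible by a Datalog program, with arbitrary assignments of the variables. -/
def DatalogExpressible {τ τ' : Schema U} (V : View τ τ') : Prop :=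
  ∃ (A : Type) (_ : Finite A) (ar : A → ℕ) (P : Program τ τ' ar),
    P.IsDatalog ∧ ComputesSets V (fun D r => P.answers Set.univ D r)

/-- `V` is expressible by a Datalog program with negation under the inflationary semantics, with
variables ranging over the active domain of the input and the program. -/
def InflationaryDatalogExpressible {τ τ' : Schema U} (V : View τ τ') : Prop :=
  ∃ (A : Type) (_ : Finite A) (ar : A → ℕ) (P : Program τ τ' ar),
    ComputesSets V (fun D r => P.answers (↑(adom D) ∪ P.consts) D r)

end Datalog

/-! ### Least fixed-point logic -/

section FixedPoint

variable {U : Type u} [MeasurableSpace U]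

/-- Formulas of least fixed-point logic with `s` relation variables of arities `Γ` and with free
variables `x₀, …, x_{n-1}`.  In `lfp k φ t`, i.e. `[LFP_{X, ȳ} φ(X, x̄, ȳ)](t)`, the bound `k`-ary
relation variable `X` has index `0` in `φ`, and `ȳ` are the last `k` variables of `φ`. -/
inductive LFPFormula (τ : Schema U) : {s : ℕ} → (Fin s → ℕ) → ℕ → Type u
  | rel {s : ℕ} {Γ : Fin s → ℕ} {n : ℕ} (r : τ.Rel) (t : Fin (τ.arity r) → Term U n) :
      LFPFormula τ Γ n
  | rvar {s : ℕ} {Γ : Fin s → ℕ} {n : ℕ} (X : Fin s) (t : Fin (Γ X) → Term U n) :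
      LFPFormula τ Γ n
  | eq {s : ℕ} {Γ : Fin s → ℕ} {n : ℕ} (t₁ t₂ : Term U n) : LFPFormula τ Γ n
  | pred {s : ℕ} {Γ : Fin s → ℕ} {n k : ℕ} (B : Set (Fin k → U)) (hB : MeasurableSet B)
      (t : Fin k → Term U n) : LFPFormula τ Γ n
  | not {s : ℕ} {Γ : Fin s → ℕ} {n : ℕ} (φ : LFPFormula τ Γ n) : LFPFormula τ Γ n
  | and {s : ℕ} {Γ : Fin s → ℕ} {n : ℕ} (φ ψ : LFPFormula τ Γ n) : LFPFormula τ Γ n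
  | or {s : ℕ} {Γ : Fin s → ℕ} {n : ℕ} (φ ψ : LFPFormula τ Γ n) : LFPFormula τ Γ n
  | ex {s : ℕ} {Γ : Fin s → ℕ} {n : ℕ} (φ : LFPFormula τ Γ (n + 1)) : LFPFormula τ Γ n
  | all {s : ℕ} {Γ : Fin s → ℕ} {n : ℕ} (φ : LFPFormula τ Γ (n + 1)) : LFPFormula τ Γ n
  | lfp {s : ℕ} {Γ : Fin s → ℕ} {n : ℕ} (k : ℕ)
      (φ : LFPFormula τ (Fin.cons k Γ : Fin (s + 1) → ℕ) (n + k)) (t : Fin k → Term U n) :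
      LFPFormula τ Γ n

/-- All occurrences of the relation variable `X` are positive (`b = true`), i.e. below an even
number of negations, respectively negative (`b = false`). -/
def LFPFormula.Polarity {τ : Schema U} : {s : ℕ} → {Γ : Fin s → ℕ} → {n : ℕ} →
    LFPFormula τ Γ n → Bool → Fin s → Prop
  | _, _, _, .rel _ _, _, _ => True
  | _, _, _, .rvar Y _, b, X => Y = X → b = true
  | _, _, _, .eq _ _, _, _ => True
  | _, _, _, .pred _ _ _, _, _ => True
  | _, _, _, .not φ, b, X => φ.Polarity (!b) X
  | _, _, _, .and φ ψ, b, X => φ.Polarity b X ∧ ψ.Polarity b X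
  | _, _, _, .or φ ψ, b, X => φ.Polarity b X ∧ ψ.Polarity b X
  | _, _, _, .ex φ, b, X => φ.Polarity b X
  | _, _, _, .all φ, b, X => φ.Polarity b X
  | _, _, _, .lfp _ φ _, b, X => φ.Polarity b X.succ

/-- Well-formedness: each fixed-point operator is applied to a formula that is positive in the
bound relation variable. -/
def LFPFormula.WellFormed {τ : Schema U} : {s : ℕ} → {Γ : Fin s → ℕ} → {n : ℕ} →
    LFPFormula τ Γ n → Prop
  | _, _, _, .rel _ _ => True
  | _, _, _, .rvar _ _ => True
  | _, _, _, .eq _ _ => True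
  | _, _, _, .pred _ _ _ => True
  | _, _, _, .not φ => φ.WellFormed
  | _, _, _, .and φ ψ => φ.WellFormed ∧ ψ.WellFormed
  | _, _, _, .or φ ψ => φ.WellFormed ∧ ψ.WellFormed
  | _, _, _, .ex φ => φ.WellFormed
  | _, _, _, .all φ => φ.WellFormed
  | _, _, _, .lfp _ φ _ => φ.WellFormed ∧ φ.Polarity true 0

/-- The constants that occur in a formula. -/
def LFPFormula.consts {τ : Schema U} : {s : ℕ} → {Γ : Fin s → ℕ} → {n : ℕ} →
    LFPFormula τ Γ n → Set U
  | _, _, _, .rel _ t => {c | ∃ i, t i = Term.const c}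
  | _, _, _, .rvar _ t => {c | ∃ i, t i = Term.const c}
  | _, _, _, .eq t₁ t₂ => {c | t₁ = Term.const c ∨ t₂ = Term.const c}
  | _, _, _, .pred _ _ t => {c | ∃ i, t i = Term.const c}
  | _, _, _, .not φ => φ.consts
  | _, _, _, .and φ ψ => φ.consts ∪ ψ.consts
  | _, _, _, .or φ ψ => φ.consts ∪ ψ.consts
  | _, _, _, .ex φ => φ.consts
  | _, _, _, .all φ => φ.consts
  | _, _, _, .lfp _ φ t => φ.consts ∪ {c | ∃ i, t i = Term.const c}

/-- Truth on the instance `D`, with first-order variables ranging over `d` and with relation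
variables interpreted by `ρ`.  The fixed point is the intersection of all relations that are closed
under the (monotone, by positivity) operator defined by the formula. -/
def LFPFormula.Sat {τ : Schema U} (D : Instance τ) (d : Set U) :
    {s : ℕ} → {Γ : Fin s → ℕ} → {n : ℕ} → LFPFormula τ Γ n →
    ((X : Fin s) → Set (Fin (Γ X) → U)) → (Fin n → U) → Prop
  | _, _, _, .rel r t, _, v => (fun i => (t i).eval v) ∈ relOf D r
  | _, _, _, .rvar X t, ρ, v => (fun i => (t i).eval v) ∈ ρ X
  | _, _, _, .eq t₁ t₂, _, v => t₁.eval v = t₂.eval v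
  | _, _, _, .pred B _ t, _, v => (fun i => (t i).eval v) ∈ B
  | _, _, _, .not φ, ρ, v => ¬ φ.Sat D d ρ v
  | _, _, _, .and φ ψ, ρ, v => φ.Sat D d ρ v ∧ ψ.Sat D d ρ v
  | _, _, _, .or φ ψ, ρ, v => φ.Sat D d ρ v ∨ ψ.Sat D d ρ v
  | _, _, _, .ex φ, ρ, v => ∃ a ∈ d, φ.Sat D d ρ (Fin.snoc (α := fun _ => U) v a)
  | _, _, _, .all φ, ρ, v => ∀ a ∈ d, φ.Sat D d ρ (Fin.snoc (α := fun _ => U) v a)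
  | s, Γ, _, .lfp k φ t, ρ, v =>
      (fun i => (t i).eval v) ∈ ⋂₀ {S : Set (Fin k → U) | ∀ a : Fin k → U, (∀ i, a i ∈ d) →
        φ.Sat D d
          (Fin.cons (α := fun X => Set (Fin ((Fin.cons k Γ : Fin (s + 1) → ℕ) X) → U)) S ρ)
          (Fin.append v a) → a ∈ S}

/-- The answers to the query `{x̄ | φ(x̄)}` under active-domain semantics; `φ` has no free relation
variables. -/
def LFPFormula.answers {τ : Schema U} {k : ℕ} (φ : LFPFormula τ (Fin.elim0 : Fin 0 → ℕ) k)
    (D : Instance τ) : Set (Fin k → U) :=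
  {t | (∀ i, t i ∈ (↑(adom D) ∪ φ.consts : Set U)) ∧
    φ.Sat D (↑(adom D) ∪ φ.consts) (fun X => X.elim0) t}

/-- `V` is expressible in least fixed-point logic. -/
def LFPExpressible {τ τ' : Schema U} (V : View τ τ') : Prop :=
  ∃ φ : (r : τ'.Rel) → LFPFormula τ (Fin.elim0 : Fin 0 → ℕ) (τ'.arity r),
    (∀ r, (φ r).WellFormed) ∧ ComputesSets V (fun D r => (φ r).answers D)

end FixedPoint

end StandardPDB

namespace StandardPDB

/-! ### Measurability of bag-valued maps -/

section BagMeasurability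

variable {Ω X Y : Type*} [MeasurableSpace Ω] [MeasurableSpace X] [MeasurableSpace Y]

@[simp]
theorem countIn_zero {X : Type*} (F : Set X) : countIn F 0 = 0 := by
  simp [countIn]

open Classical in
theorem countIn_cons {X : Type*} (F : Set X) (a : X) (D : Multiset X) :
    countIn F (a ::ₘ D) = countIn F D + if a ∈ F then 1 else 0 := by
  simp [countIn, Multiset.countP_cons]

theorem countIn_add {X : Type*} (F : Set X) (D E : Multiset X) :
    countIn F (D + E) = countIn F D + countIn F E := by
  simp [countIn]

theorem countIn_map {X Y : Type*} (f : X → Y) (F : Set Y) (D : Multiset X) :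
    countIn F (D.map f) = countIn (f ⁻¹' F) D := by
  classical
  induction D using Multiset.induction_on with
  | empty => simp
  | cons a D ih => simp [countIn_cons, ih]

theorem countIn_filter {X : Type*} (p : X → Prop) [DecidablePred p] (F : Set X)
    (D : Multiset X) : countIn F (D.filter p) = countIn (F ∩ {x | p x}) D := by
  classical
  induction D using Multiset.induction_on with
  | empty => simp
  | cons a D ih =>
    by_cases h : p a <;> simp [countIn_cons, h, ih]

theorem countIn_bind {X Y : Type*} (D : Multiset X) (h : X → Multiset Y) (F : Set Y) :
    (countIn F (D.bind h) : ℝ) = (D.map fun x => (countIn F (h x) : ℝ)).sum := by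
  induction D using Multiset.induction_on with
  | empty => simp
  | cons a D ih => simp [countIn_add, ih]

theorem countIn_eq_zero_iff {X : Type*} {F : Set X} {D : Multiset X} :
    countIn F D = 0 ↔ ∀ x ∈ D, x ∉ F := by
  simp [countIn, Multiset.countP_eq_zero]

theorem count_eq_countIn {X : Type*} [DecidableEq X] (x : X) (D : Multiset X) :
    D.count x = countIn {y | x = y} D := by
  classical
  induction D using Multiset.induction_on with
  | empty => simp
  | cons a D ih => simp [countIn_cons, Multiset.count_cons, ih, eq_comm]

theorem countIn_compl {X : Type*} (F : Set X) (D : Multiset X) :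
    countIn Fᶜ D = D.card - countIn F D := by
  classical
  have : countIn F D + countIn Fᶜ D = D.card := by
    induction D using Multiset.induction_on with
    | empty => simp
    | cons a D ih => by_cases h : a ∈ F <;> simp [countIn_cons, h] <;> omega
  omega

open ENNReal in
theorem countIn_iUnion {X : Type*} {F : ℕ → Set X} (hF : Pairwise (Function.onFun Disjoint F))
    (D : Multiset X) : (countIn (⋃ i, F i) D : ℝ≥0∞) = ∑' i, (countIn (F i) D : ℝ≥0∞) := by
  classical
  induction D using Multiset.induction_on with
  | empty => simp
  | cons a D ih =>
    simp only [countIn_cons, Nat.cast_add, ENNReal.tsum_add, ih]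
    congr 1
    by_cases h : ∃ i, a ∈ F i
    · obtain ⟨i, hi⟩ := h
      rw [tsum_eq_single i]
      · simp only [Set.mem_iUnion, hi, if_true]
        rw [if_pos ⟨i, hi⟩]
      · intro j hj
        have : a ∉ F j := fun h => Set.disjoint_left.1 (hF hj) h hi
        simp [this]
    · have h' : ∀ i, a ∉ F i := by simpa using h
      simp [h']

theorem measurable_bag {g : Ω → Multiset X}
    (hg : ∀ F, MeasurableSet F → Measurable fun ω => countIn F (g ω)) : Measurable g := by
  refine measurable_generateFrom ?_
  rintro _ ⟨F, n, hF, rfl⟩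
  exact hg F hF (measurableSet_singleton n)

theorem measurable_countIn_bag {g : Ω → Multiset X} (hg : Measurable g) {F : Set X}
    (hF : MeasurableSet F) : Measurable fun ω => countIn F (g ω) :=
  (measurable_countIn hF).comp hg

theorem measurable_of_natCast_real {f : Ω → ℕ} (hf : Measurable fun ω => (f ω : ℝ)) :
    Measurable f := by
  refine measurable_to_countable' fun n => ?_
  convert hf (measurableSet_singleton (n : ℝ)) using 1
  ext ω
  simp

open ENNReal in
theorem measurable_of_natCast_ennreal {f : Ω → ℕ} (hf : Measurable fun ω => (f ω : ℝ≥0∞)) :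
    Measurable f := by
  refine measurable_to_countable' fun n => ?_
  convert hf (measurableSet_singleton (n : ℝ≥0∞)) using 1
  ext ω
  simp

/-- Attaching the parameter to the elements of a bag is measurable. -/
theorem measurable_map_prodMk {g : Ω → Multiset X} (hg : Measurable g) :
    Measurable fun ω => (g ω).map (Prod.mk ω) := by
  classical
  refine measurable_bag fun F hF => ?_
  induction F, hF using MeasurableSpace.induction_on_inter generateFrom_prod.symm isPiSystem_prod with
  | empty => simp [countIn]
  | basic t ht =>
    obtain ⟨A, hA, B, hB, rfl⟩ := ht
    have : (fun ω => countIn (A ×ˢ B) ((g ω).map (Prod.mk ω))) =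
        fun ω => if ω ∈ A then countIn B (g ω) else 0 := by
      funext ω
      rw [countIn_map]
      split_ifs with h
      · congr 1
        ext x
        simp [h]
      · simp [countIn_eq_zero_iff, h]
    rw [this]
    exact Measurable.ite hA (measurable_countIn_bag hg hB) measurable_const
  | compl t ht ih =>
    simp only [countIn_compl, Multiset.card_map]
    exact (measurable_card.comp hg).sub ih
  | iUnion f hd hf ih =>
    refine measurable_of_natCast_ennreal ?_
    simp only [countIn_iUnion hd]
    exact Measurable.tsum fun i => measurable_from_top.comp (ih i)

theorem _root_.Measurable.bag_map {g : Ω → Multiset X} (hg : Measurable g) {f : Ω → X → Y}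
    (hf : Measurable (Function.uncurry f)) : Measurable fun ω => (g ω).map (f ω) := by
  refine measurable_bag fun F hF => ?_
  have : ∀ ω, countIn F ((g ω).map (f ω)) =
      countIn (Function.uncurry f ⁻¹' F) ((g ω).map (Prod.mk ω)) := by
    intro ω
    simp only [countIn_map]
    rfl
  simp only [this]
  exact measurable_countIn_bag (measurable_map_prodMk hg) (hf hF)

theorem _root_.Measurable.bag_filter {g : Ω → Multiset X} (hg : Measurable g)
    {p : Ω → X → Prop} [∀ ω, DecidablePred (p ω)]
    (hp : MeasurableSet {q : Ω × X | p q.1 q.2}) : Measurable fun ω => (g ω).filter (p ω) := by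
  refine measurable_bag fun F hF => ?_
  have : ∀ ω, countIn F ((g ω).filter (p ω)) =
      countIn (Prod.snd ⁻¹' F ∩ {q : Ω × X | p q.1 q.2}) ((g ω).map (Prod.mk ω)) := by
    intro ω
    rw [countIn_filter, countIn_map]
    rfl
  simp only [this]
  exact measurable_countIn_bag (measurable_map_prodMk hg) ((measurable_snd hF).inter hp)

theorem _root_.Measurable.bag_sum {g : Ω → Multiset X} (hg : Measurable g) {f : Ω → X → ℝ}
    (hf : Measurable (Function.uncurry f)) : Measurable fun ω => ((g ω).map (f ω)).sum := by
  have h := (measurable_map_sum hf).comp (measurable_map_prodMk hg)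
  simpa [Function.comp_def, Function.uncurry] using h

theorem _root_.Measurable.bag_bind {g : Ω → Multiset X} (hg : Measurable g) {h : Ω → X → Multiset Y}
    (hh : Measurable (Function.uncurry h)) : Measurable fun ω => (g ω).bind (h ω) := by
  refine measurable_bag fun F hF => measurable_of_natCast_real ?_
  simp only [countIn_bind]
  exact hg.bag_sum (measurable_from_top.comp (measurable_countIn_bag hh hF))

theorem _root_.Measurable.bag_add {g h : Ω → Multiset X} (hg : Measurable g) (hh : Measurable h) :
    Measurable fun ω => g ω + h ω := by
  refine measurable_bag fun F hF => ?_
  simp only [countIn_add]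
  exact (measurable_countIn_bag hg hF).add (measurable_countIn_bag hh hF)

theorem _root_.Measurable.bag_singleton {f : Ω → X} (hf : Measurable f) :
    Measurable fun ω => ({f ω} : Multiset X) := by
  classical
  refine measurable_bag fun F hF => ?_
  simp only [← Multiset.cons_zero, countIn_cons, countIn_zero]
  exact measurable_const.add (Measurable.ite (hf hF) measurable_const measurable_const)

theorem _root_.Measurable.bag_product {g : Ω → Multiset X} {h : Ω → Multiset Y} (hg : Measurable g)
    (hh : Measurable h) : Measurable fun ω => g ω ×ˢ h ω := by
  change Measurable fun ω => (g ω).bind fun x => (h ω).map (Prod.mk x)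
  exact hg.bag_bind (Measurable.bag_map (hh.comp measurable_fst)
    (f := fun (p : Ω × X) y => (p.2, y)) (by fun_prop))

theorem _root_.Measurable.bag_exists {g : Ω → Multiset X} (hg : Measurable g) {S : Ω → Set X}
    (hS : MeasurableSet {p : Ω × X | p.2 ∈ S p.1}) : MeasurableSet {ω | ∃ x ∈ g ω, x ∈ S ω} := by
  have : {ω | ∃ x ∈ g ω, x ∈ S ω} =
      (fun ω => countIn {p : Ω × X | p.2 ∈ S p.1} ((g ω).map (Prod.mk ω))) ⁻¹' {0}ᶜ := by
    ext ω
    simp [countIn_eq_zero_iff]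
  rw [this]
  exact measurable_countIn_bag (measurable_map_prodMk hg) hS (measurableSet_singleton 0).compl

theorem _root_.Measurable.bag_forall {g : Ω → Multiset X} (hg : Measurable g) {S : Ω → Set X}
    (hS : MeasurableSet {p : Ω × X | p.2 ∈ S p.1}) : MeasurableSet {ω | ∀ x ∈ g ω, x ∈ S ω} := by
  have h := (hg.bag_exists (S := fun ω => (S ω)ᶜ) hS.compl).compl
  convert h using 1
  ext ω
  simp

theorem _root_.Measurable.bag_count [MeasurableEq X] [DecidableEq X] {g : Ω → Multiset X}
    (hg : Measurable g) {f : Ω → X} (hf : Measurable f) :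
    Measurable fun ω => (g ω).count (f ω) := by
  have : ∀ ω, (g ω).count (f ω) =
      countIn {p : Ω × X | f p.1 = p.2} ((g ω).map (Prod.mk ω)) := by
    intro ω
    rw [countIn_map, count_eq_countIn]
    rfl
  simp only [this]
  exact measurable_countIn_bag (measurable_map_prodMk hg)
    (measurableSet_eq_fun (hf.comp measurable_fst) measurable_snd)

theorem _root_.Measurable.bag_mem [MeasurableEq X] {g : Ω → Multiset X} (hg : Measurable g) {f : Ω → X}
    (hf : Measurable f) : MeasurableSet {ω | f ω ∈ g ω} := by
  classical
  have h := hg.bag_count hf (measurableSet_singleton 0).compl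
  convert h using 1
  ext ω
  simp

/-- A bag is measurable if its multiplicities are jointly measurable and its elements belong to a
measurable bag. -/
theorem measurable_bag_of_count [MeasurableEq X] [DecidableEq X] {g h : Ω → Multiset X}
    (hg : Measurable g) (hh : Measurable fun p : Ω × X => (h p.1).count p.2)
    (hsub : ∀ ω, ∀ x ∈ h ω, x ∈ g ω) : Measurable h := by
  classical
  refine measurable_bag fun F hF => measurable_of_natCast_real ?_
  have key : ∀ ω, (countIn F (h ω) : ℝ) = ((g ω).map fun x =>
      if x ∈ F then ((h ω).count x : ℝ) / (g ω).count x else 0).sum := by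
    intro ω
    rw [Finset.sum_multiset_map_count]
    have e : countIn F (h ω) = ((h ω).filter (· ∈ F)).card := by
      simp [countIn, Multiset.countP_eq_card_filter]
    rw [e, ← Multiset.sum_count_eq_card (s := (g ω).toFinset)
      (fun x hx => by simpa using hsub ω x (Multiset.mem_of_mem_filter hx)), Nat.cast_sum]
    refine Finset.sum_congr rfl fun x hx => ?_
    have hx' : ((g ω).count x : ℝ) ≠ 0 := by
      simpa using hx
    by_cases h : x ∈ F
    · simp only [h, if_true, nsmul_eq_mul, Multiset.count_filter_of_pos h]
      field_simp
    · simp [h]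
  simp only [key]
  refine hg.bag_sum (f := fun ω x => if x ∈ F then ((h ω).count x : ℝ) / (g ω).count x else 0) ?_
  refine Measurable.ite (measurable_snd hF) (Measurable.div ?_ ?_) measurable_const
  · exact measurable_from_top.comp hh
  · exact measurable_from_top.comp ((hg.comp measurable_fst).bag_count measurable_snd)

section Lattice

variable [MeasurableEq X] [DecidableEq X] {g h : Ω → Multiset X}

theorem _root_.Measurable.bag_dedup (hg : Measurable g) : Measurable fun ω => (g ω).dedup := by
  refine measurable_bag_of_count hg ?_ fun ω x hx => by simpa using hx
  simp only [Multiset.count_dedup]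
  exact Measurable.ite ((hg.comp measurable_fst).bag_mem measurable_snd)
    measurable_const measurable_const

theorem _root_.Measurable.bag_union (hg : Measurable g) (hh : Measurable h) :
    Measurable fun ω => g ω ∪ h ω := by
  refine measurable_bag_of_count (hg.bag_add hh) ?_ fun ω x hx => by simpa using hx
  simp only [Multiset.count_union]
  exact ((hg.comp measurable_fst).bag_count measurable_snd).max
    ((hh.comp measurable_fst).bag_count measurable_snd)

theorem _root_.Measurable.bag_inter (hg : Measurable g) (hh : Measurable h) :
    Measurable fun ω => g ω ∩ h ω := by
  refine measurable_bag_of_count hg ?_ fun ω x hx => (Multiset.mem_inter.1 hx).1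
  simp only [Multiset.count_inter]
  exact ((hg.comp measurable_fst).bag_count measurable_snd).min
    ((hh.comp measurable_fst).bag_count measurable_snd)

theorem _root_.Measurable.bag_sub (hg : Measurable g) (hh : Measurable h) :
    Measurable fun ω => g ω - h ω := by
  refine measurable_bag_of_count hg ?_ fun ω x hx => Multiset.mem_of_le (Multiset.sub_le_self _ _) hx
  simp only [Multiset.count_sub]
  exact ((hg.comp measurable_fst).bag_count measurable_snd).sub
    ((hh.comp measurable_fst).bag_count measurable_snd)

end Lattice

/-- A duplicate-free bag is measurable if membership is jointly measurable and its elements belong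
to a measurable bag. -/
theorem measurable_bag_of_mem [MeasurableEq X] {g h : Ω → Multiset X} (hg : Measurable g)
    (hnd : ∀ ω, (h ω).Nodup) (hh : MeasurableSet {p : Ω × X | p.2 ∈ h p.1})
    (hsub : ∀ ω, ∀ x ∈ h ω, x ∈ g ω) : Measurable h := by
  classical
  refine measurable_bag_of_count hg ?_ hsub
  simp only [fun p : Ω × X => Multiset.count_eq_of_nodup (a := p.2) (hnd p.1)]
  exact Measurable.ite hh measurable_const measurable_const

/-- Tuples over a measurable finite set. -/
theorem _root_.Measurable.bag_piFinset [MeasurableEq X] {d : Ω → Finset X}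
    (hd : Measurable fun ω => (d ω).val) (m : ℕ) :
    Measurable fun ω => (Fintype.piFinset fun _ : Fin m => d ω).val := by
  classical
  induction m with
  | zero =>
    have : (fun ω => (Fintype.piFinset fun _ : Fin 0 => d ω).val) =
        fun _ => {(fun i => i.elim0 : Fin 0 → X)} := by
      funext ω
      simp only [Fintype.piFinset_of_isEmpty]
      rfl
    rw [this]
    exact measurable_const
  | succ m ih =>
    have : (fun ω => (Fintype.piFinset fun _ : Fin (m + 1) => d ω).val) = fun ω =>
        ((d ω).val ×ˢ (Fintype.piFinset fun _ : Fin m => d ω).val).map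
          fun p => (Fin.cons p.1 p.2 : Fin (m + 1) → X) := by
      funext ω
      refine (Multiset.Nodup.ext (Finset.nodup _) ?_).2 ?_
      · refine Multiset.Nodup.map ?_ ((d ω).product _).nodup
        rintro ⟨a, v⟩ ⟨b, w⟩ h
        simpa [Fin.cons_inj] using h
      · intro t
        simp only [Finset.mem_val, Fintype.mem_piFinset, Multiset.mem_map, Multiset.mem_product,
          Prod.exists]
        constructor
        · intro h
          exact ⟨t 0, Fin.tail t, ⟨h 0, fun i => h i.succ⟩, Fin.cons_self_tail t⟩
        · rintro ⟨a, v, ⟨ha, hv⟩, rfl⟩ i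
          induction i using Fin.cases with
          | zero => simpa using ha
          | succ i => simpa using hv i
    rw [this]
    refine (hd.bag_product ih).bag_map (f := fun _ (p : X × (Fin m → X)) =>
      (Fin.cons p.1 p.2 : Fin (m + 1) → X)) ?_
    refine measurable_pi_lambda _ fun i => ?_
    induction i using Fin.cases with
    | zero => exact measurable_snd.fst
    | succ i => exact (measurable_pi_apply i).comp measurable_snd.snd

end BagMeasurability

/-! ### Measurability of the relations and the active domain of an instance -/

section DatabaseMeasurability

variable {U : Type u} [MeasurableSpace U]

/-- The values of a fact. -/
def Fact.values {τ : Schema U} {r : τ.Rel} (t : (i : Fin (τ.arity r)) → τ.dom r i) :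
    Fin (τ.arity r) → U :=
  fun i => t i

theorem measurable_factValues {τ : Schema U} (r : τ.Rel) :
    Measurable (Fact.values (τ := τ) (r := r)) :=
  measurable_pi_lambda _ fun i => measurable_subtype_coe.comp (measurable_pi_apply i)

theorem injective_factValues {τ : Schema U} (r : τ.Rel) :
    Function.Injective (Fact.values (τ := τ) (r := r)) := by
  intro s t h
  funext i
  exact Subtype.ext (congrFun h i)

theorem measurableSet_image_factValues [StandardBorelSpace U] {τ : Schema U} (r : τ.Rel)
    {S : Set ((i : Fin (τ.arity r)) → τ.dom r i)} (hS : MeasurableSet S) :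
    MeasurableSet (Fact.values '' S) := by
  have := fun i => (τ.measurableSet_dom r i).standardBorel
  exact ((measurable_factValues r).measurableEmbedding
    (injective_factValues r)).measurableSet_image' hS

theorem relOf_zero {τ : Schema U} (r : τ.Rel) : relOf (0 : Instance τ) r = 0 := by
  simp [relOf]

theorem relOf_cons_self {τ : Schema U} (r : τ.Rel) (t : (i : Fin (τ.arity r)) → τ.dom r i)
    (D : Instance τ) : relOf ((⟨r, t⟩ : Fact τ) ::ₘ D) r = Fact.values t ::ₘ relOf D r := by
  classical
  unfold relOf
  rw [Multiset.filterMap_cons]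
  simp
  rfl

theorem relOf_cons_of_ne {τ : Schema U} {r : τ.Rel} {f : Fact τ} (h : f.1 ≠ r)
    (D : Instance τ) : relOf (f ::ₘ D) r = relOf D r := by
  classical
  unfold relOf
  rw [Multiset.filterMap_cons]
  simp [h]

theorem measurable_reindex {m n : ℕ} (f : Fin m → Fin n) :
    Measurable fun t : Fin n → U => t ∘ f :=
  measurable_pi_lambda _ fun i => measurable_pi_apply (f i)

theorem measurable_finAppend {m n : ℕ} :
    Measurable fun p : (Fin m → U) × (Fin n → U) => Fin.append p.1 p.2 := by
  refine measurable_pi_lambda _ fun i => ?_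
  induction i using Fin.addCases with
  | left i => simpa using measurable_fst.eval
  | right i => simpa using measurable_snd.eval

theorem measurable_finSnoc {n : ℕ} :
    Measurable fun p : (Fin n → U) × U => (Fin.snoc (α := fun _ => U) p.1 p.2 : Fin (n + 1) → U) := by
  refine measurable_pi_lambda _ fun i => ?_
  induction i using Fin.lastCases with
  | last => simpa using measurable_snd
  | cast i => simpa using measurable_fst.eval

theorem measurableSet_sigma {ι : Type*} {β : ι → Type*} [∀ i, MeasurableSpace (β i)]
    {S : Set (Sigma β)} : MeasurableSet S ↔ ∀ i, MeasurableSet (Sigma.mk i ⁻¹' S) := by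
  rw [MeasurableSpace.measurableSet_iInf]
  rfl

theorem countIn_relOf {τ : Schema U} (r : τ.Rel) (G : Set (Fin (τ.arity r) → U))
    (D : Instance τ) :
    countIn G (relOf D r) = countIn (Sigma.mk r '' (Fact.values ⁻¹' G)) D := by
  classical
  induction D using Multiset.induction_on with
  | empty => simp [relOf_zero]
  | cons f D ih =>
    obtain ⟨s, t⟩ := f
    by_cases h : s = r
    · subst h
      rw [relOf_cons_self, countIn_cons, countIn_cons, ih]
      congr 2
      simp
    · rw [relOf_cons_of_ne h, countIn_cons, ih, if_neg, add_zero]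
      rintro ⟨t', -, h'⟩
      exact h (congrArg Sigma.fst h').symm

theorem measurable_relOf {τ : Schema U} (r : τ.Rel) :
    Measurable fun D : Instance τ => relOf D r := by
  classical
  refine measurable_bag fun G hG => ?_
  simp only [countIn_relOf]
  refine measurable_countIn (measurableSet_sigma.2 fun s => ?_)
  by_cases h : s = r
  · subst h
    rw [Set.preimage_image_eq _ sigma_mk_injective]
    exact measurable_factValues s hG
  · rw [Set.preimage_image_sigmaMk_of_ne h]
    exact MeasurableSet.empty

open Classical in
theorem countIn_eq_sum_relOf {τ : Schema U} [Fintype τ.Rel] (F : Set (Fact τ)) (D : Instance τ) :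
    countIn F D = ∑ r, countIn (Fact.values '' {s | (⟨r, s⟩ : Fact τ) ∈ F}) (relOf D r) := by
  induction D using Multiset.induction_on with
  | empty => simp [relOf_zero]
  | cons f D ih =>
    obtain ⟨s, t⟩ := f
    have : ∀ r, countIn (Fact.values '' {s | (⟨r, s⟩ : Fact τ) ∈ F}) (relOf ((⟨s, t⟩ : Fact τ) ::ₘ D) r) =
        countIn (Fact.values '' {s | (⟨r, s⟩ : Fact τ) ∈ F}) (relOf D r) +
          if r = s then (if (⟨s, t⟩ : Fact τ) ∈ F then 1 else 0) else 0 := by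
      intro r
      by_cases h : r = s
      · subst h
        rw [relOf_cons_self, countIn_cons, if_pos rfl]
        congr 2
        rw [(injective_factValues r).mem_set_image]
        rfl
      · rw [relOf_cons_of_ne (Ne.symm h), if_neg h, add_zero]
    simp only [this, Finset.sum_add_distrib, ← ih, countIn_cons, Finset.sum_ite_eq',
      Finset.mem_univ, if_true]

/-- A map into instances is measurable if each relation of its value is. -/
theorem measurable_of_relOf [StandardBorelSpace U] {Ω : Type*} [MeasurableSpace Ω] {τ : Schema U}
    {V : Ω → Instance τ} (h : ∀ r, Measurable fun ω => relOf (V ω) r) : Measurable V := by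
  have := τ.finite_rel
  have := Fintype.ofFinite τ.Rel
  refine measurable_bag fun F hF => ?_
  simp only [countIn_eq_sum_relOf]
  exact Finset.measurable_sum _ fun r _ => measurable_countIn_bag (h r)
    (measurableSet_image_factValues r (measurableSet_sigma.1 hF r))

theorem mem_adom {τ : Schema U} {D : Instance τ} {a : U} :
    a ∈ adom D ↔ ∃ r, ∃ t ∈ relOf D r, ∃ i, t i = a := by
  classical
  have h : ∀ r t, t ∈ relOf D r ↔ ∃ s, (⟨r, s⟩ : Fact τ) ∈ D ∧ Fact.values s = t := by
    intro r t
    have e := not_congr ((countIn_eq_zero_iff (F := {t}) (D := relOf D r)))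
    rw [countIn_relOf, countIn_eq_zero_iff] at e
    simp only [Set.mem_singleton_iff, Set.mem_image, Set.mem_preimage] at e
    push Not at e
    constructor
    · intro ht
      obtain ⟨f, hf, s, hs, rfl⟩ := e.2 ⟨t, ht, rfl⟩
      exact ⟨s, hf, hs⟩
    · rintro ⟨s, hs, rfl⟩
      obtain ⟨x, hx, rfl⟩ := e.1 ⟨_, hs, s, rfl, rfl⟩
      exact hx
  simp only [adom, Multiset.mem_toFinset, Multiset.mem_bind, Multiset.mem_map, Finset.mem_val,
    Finset.mem_univ, true_and, h]
  constructor
  · rintro ⟨⟨r, s⟩, hs, i, rfl⟩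
    exact ⟨r, _, ⟨s, hs, rfl⟩, i, rfl⟩
  · rintro ⟨r, _, ⟨s, hs, rfl⟩, i, rfl⟩
    exact ⟨⟨r, s⟩, hs, i, rfl⟩

theorem measurable_finset_sum_bag {Ω X ι : Type*} [MeasurableSpace Ω] [MeasurableSpace X]
    (s : Finset ι) {g : ι → Ω → Multiset X} (hg : ∀ i, Measurable (g i)) :
    Measurable fun ω => ∑ i ∈ s, g i ω := by
  classical
  induction s using Finset.induction_on with
  | empty => simp
  | insert a s ha ih => simpa [Finset.sum_insert ha] using (hg a).bag_add ih

theorem measurable_adom [MeasurableEq U] {τ : Schema U} :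
    Measurable fun D : Instance τ => (adom D).val := by
  classical
  have := τ.finite_rel
  have := Fintype.ofFinite τ.Rel
  have : (fun D : Instance τ => (adom D).val) = fun D =>
      (∑ r, ∑ i, (relOf D r).map fun t => t i).dedup := by
    funext D
    refine (Multiset.Nodup.ext (Finset.nodup _) (Multiset.nodup_dedup _)).2 fun a => ?_
    rw [Finset.mem_val, mem_adom, Multiset.mem_dedup, Multiset.mem_sum]
    simp only [Finset.mem_univ, true_and, Multiset.mem_sum, Multiset.mem_map]
    exact exists_congr fun r => ⟨fun ⟨t, ht, i, h⟩ => ⟨i, t, ht, h⟩, fun ⟨i, t, ht, h⟩ => ⟨t, ht, i, h⟩⟩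
  rw [this]
  exact (measurable_finset_sum_bag _ fun r => measurable_finset_sum_bag _ fun i =>
    (measurable_relOf r).bag_map (f := fun _ t => t i)
      measurable_snd.eval).bag_dedup

theorem _root_.Measurable.finset_union {Ω X : Type*} [MeasurableSpace Ω] [MeasurableSpace X]
    [MeasurableEq X] [DecidableEq X] {d e : Ω → Finset X} (hd : Measurable fun ω => (d ω).val)
    (he : Measurable fun ω => (e ω).val) : Measurable fun ω => (d ω ∪ e ω).val := by
  simp only [Finset.union_val]
  exact hd.bag_union he

/-- A view that computes sets of tuples is measurable if membership in the answers is jointly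
measurable and the answers range over a measurable finite set of values. -/
theorem ComputesSets.measurable [StandardBorelSpace U] {τ τ' : Schema U} {V : View τ τ'}
    {ans : Instance τ → (r : τ'.Rel) → Set (Fin (τ'.arity r) → U)} (h : ComputesSets V ans)
    {d : Instance τ → Finset U} (hd : Measurable fun D => (d D).val)
    (hm : ∀ r, MeasurableSet {p : Instance τ × (Fin (τ'.arity r) → U) | p.2 ∈ ans p.1 r})
    (hsub : ∀ D r, ∀ t ∈ ans D r, ∀ i, t i ∈ d D) : Measurable V := by
  refine measurable_of_relOf fun r => ?_
  refine measurable_bag_of_mem (hd.bag_piFinset (τ'.arity r)) (fun D => (h D r).1) ?_ ?_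
  · simpa only [(h _ r).2] using hm r
  · intro D t ht
    simpa using hsub D r t (((h D r).2 t).1 ht)

end DatabaseMeasurability

/-! ### Bag relational algebra -/

section AlgebraMeasurability

variable {U : Type u} [MeasurableSpace U] [StandardBorelSpace U]

theorem BagExpr.measurable_eval {τ : Schema U} {k : ℕ} (e : BagExpr τ k) :
    Measurable fun D : Instance τ => e.eval D := by
  classical
  induction e with
  | rel r => exact measurable_relOf r
  | single t => exact measurable_const
  | select B hB e ih => exact ih.bag_filter (p := fun _ t => t ∈ B) (measurable_snd hB)
  | project f e ih => exact ih.bag_map ((measurable_reindex f).comp measurable_snd)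
  | product e₁ e₂ ih₁ ih₂ =>
    exact (ih₁.bag_product ih₂).bag_map (measurable_finAppend.comp measurable_snd)
  | addUnion e₁ e₂ ih₁ ih₂ => exact ih₁.bag_add ih₂
  | maxUnion e₁ e₂ ih₁ ih₂ => simpa only [BagExpr.eval] using ih₁.bag_union ih₂
  | inter e₁ e₂ ih₁ ih₂ => simpa only [BagExpr.eval] using ih₁.bag_inter ih₂
  | diff e₁ e₂ ih₁ ih₂ => simpa only [BagExpr.eval] using ih₁.bag_sub ih₂
  | dedup e ih => simpa only [BagExpr.eval] using ih.bag_dedup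
  | aggregate Φ arg e ih =>
    refine Measurable.bag_singleton (measurable_pi_lambda _ fun _ => ?_)
    exact Φ.measurable_toFun.comp (ih.bag_map ((measurable_reindex arg).comp measurable_snd))
  | @groupBy k m l key Φ arg e ih =>
    refine (ih.bag_map (f := fun _ t => t ∘ key)
      ((measurable_reindex key).comp measurable_snd)).bag_dedup.bag_map ?_
    refine measurable_finSnoc.comp (measurable_snd.prodMk (Φ.measurable_toFun.comp ?_))
    refine Measurable.bag_map ?_ ((measurable_reindex arg).comp measurable_snd)
    refine (ih.comp measurable_fst).bag_filter
      (p := fun p t => t ∘ key = p.2) ?_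
    exact measurableSet_eq_fun ((measurable_reindex key).comp measurable_snd)
      (measurable_snd.comp measurable_fst)

theorem AlgebraExpressible.measurable {τ τ' : Schema U} {V : View τ τ'}
    (h : AlgebraExpressible V) : Measurable V := by
  obtain ⟨E, hE⟩ := h
  refine measurable_of_relOf fun r => ?_
  simpa only [hE] using (E r).measurable_eval

end AlgebraMeasurability

/-! ### Relational calculus with aggregation -/

section CalculusMeasurability

variable {U : Type u} [MeasurableSpace U] [StandardBorelSpace U] {τ : Schema U}
  {Ω : Type*} [MeasurableSpace Ω] {D : Ω → Instance τ} {d : Ω → Finset U}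

mutual

theorem CalcTerm.measurable_eval (hD : Measurable D) (hd : Measurable fun ω => (d ω).val) {n : ℕ}
    (s : CalcTerm τ n) : Measurable fun p : Ω × (Fin n → U) => s.eval (D p.1) (d p.1) p.2 := by
  classical
  match s with
  | .var i => exact (measurable_pi_apply i).comp measurable_snd
  | .const c => exact measurable_const
  | .agg (m := m) Φ s ψ =>
    have hs := fun i => (s i).measurable_eval hD hd
    have hψ := ψ.measurableSet_sat hD hd
    have hext : Measurable fun q : (Ω × (Fin n → U)) × (Fin m → U) =>
        (q.1.1, Fin.append q.1.2 q.2) :=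
      measurable_fst.fst.prodMk (measurable_finAppend.comp (measurable_fst.snd.prodMk measurable_snd))
    simp only [CalcTerm.eval]
    refine Φ.measurable_toFun.comp (Measurable.bag_map ?_
      (measurable_pi_lambda _ fun i => (hs i).comp hext))
    exact ((hd.comp measurable_fst).bag_piFinset m).bag_filter
      (p := fun p z => Fin.append p.2 z ∈ ψ.sat (D p.1) (d p.1)) (hext hψ)

theorem CalcFormula.measurableSet_sat (hD : Measurable D) (hd : Measurable fun ω => (d ω).val)
    {n : ℕ} (φ : CalcFormula τ n) :
    MeasurableSet {p : Ω × (Fin n → U) | p.2 ∈ φ.sat (D p.1) (d p.1)} := by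
  match φ with
  | .rel r s =>
    exact ((measurable_relOf r).comp (hD.comp measurable_fst)).bag_mem
      (measurable_pi_lambda _ fun i => (s i).measurable_eval hD hd)
  | .eq s₁ s₂ => exact measurableSet_eq_fun (s₁.measurable_eval hD hd) (s₂.measurable_eval hD hd)
  | .pred B hB s => exact (measurable_pi_lambda _ fun i => (s i).measurable_eval hD hd) hB
  | .not φ => exact (φ.measurableSet_sat hD hd).compl
  | .and φ ψ => exact (φ.measurableSet_sat hD hd).inter (ψ.measurableSet_sat hD hd)
  | .or φ ψ => exact (φ.measurableSet_sat hD hd).union (ψ.measurableSet_sat hD hd)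
  | .ex φ =>
    exact (hd.comp measurable_fst).bag_exists (S := fun p : Ω × (Fin n → U) =>
      {a | (Fin.snoc (α := fun _ => U) p.2 a : Fin (n + 1) → U) ∈ φ.sat (D p.1) (d p.1)})
      ((measurable_fst.fst.prodMk
        (measurable_finSnoc.comp (measurable_fst.snd.prodMk measurable_snd)))
        (φ.measurableSet_sat hD hd))
  | .all φ =>
    exact (hd.comp measurable_fst).bag_forall (S := fun p : Ω × (Fin n → U) =>
      {a | (Fin.snoc (α := fun _ => U) p.2 a : Fin (n + 1) → U) ∈ φ.sat (D p.1) (d p.1)})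
      ((measurable_fst.fst.prodMk
        (measurable_finSnoc.comp (measurable_fst.snd.prodMk measurable_snd)))
        (φ.measurableSet_sat hD hd))

end

theorem CalculusExpressible.measurable {τ' : Schema U} {V : View τ τ'}
    (h : CalculusExpressible V) : Measurable V := by
  classical
  obtain ⟨Q, hQ⟩ := h
  refine measurable_of_relOf fun r => ?_
  have hd : Measurable fun D => ((Q r).activeDomain D).val := by
    unfold CalcQuery.activeDomain
    exact (measurable_adom.finset_union measurable_const).finset_union measurable_const
  have e : (fun D => relOf (V D) r) = fun D =>
      (((Fintype.piFinset fun _ : Fin (Q r).n => (Q r).activeDomain D).val.filter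
        (· ∈ (Q r).body.sat D ((Q r).activeDomain D))).map fun v j =>
          ((Q r).head j).eval D ((Q r).activeDomain D) v).dedup := by
    funext D
    refine (Multiset.Nodup.ext (hQ D r).1 (Multiset.nodup_dedup _)).2 fun t => ?_
    rw [(hQ D r).2]
    simp [CalcQuery.answers, and_assoc, eq_comm]
  rw [e]
  refine (Measurable.bag_map ?_ ?_).bag_dedup
  · exact (hd.bag_piFinset _).bag_filter
      (CalcFormula.measurableSet_sat (D := fun D : Instance τ => D) measurable_id hd _)
  · exact measurable_pi_lambda _ fun j =>
      CalcTerm.measurable_eval (D := fun D : Instance τ => D) measurable_id hd _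

end CalculusMeasurability

/-! ### Datalog -/

section DatalogMeasurability

theorem Term.finite_consts {U : Type u} {n k : ℕ} (t : Fin k → Term U n) :
    {c | ∃ i, t i = Term.const c}.Finite :=
  (Set.finite_range t).preimage (f := Term.const) fun _ _ _ _ h => Term.const.inj h

theorem Term.measurable_eval {U : Type u} [MeasurableSpace U] {n : ℕ} (t : Term U n) :
    Measurable fun v : Fin n → U => t.eval v := by
  cases t with
  | var i => exact measurable_pi_apply i
  | const c => exact measurable_const

variable {U : Type u} [MeasurableSpace U] {τ τ' : Schema U} {A : Type} {ar : A → ℕ}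

theorem Program.finite_consts (P : Program τ τ' ar) : P.consts.Finite := by
  have : P.consts ⊆ ⋃ ρ ∈ {ρ | ρ ∈ P}, ({c | ∃ i, ρ.head.args i = Term.const c} ∪
      ((⋃ a ∈ {a | a ∈ ρ.pos}, {c | ∃ i, a.args i = Term.const c}) ∪
        ⋃ a ∈ {a | a ∈ ρ.neg}, {c | ∃ i, a.args i = Term.const c})) := by
    rintro c ⟨ρ, hρ, h⟩
    refine Set.mem_biUnion hρ ?_
    simpa using h
  exact ((List.finite_toSet P).biUnion fun ρ _ => (Term.finite_consts _).union
    (((List.finite_toSet ρ.pos).biUnion fun a _ => Term.finite_consts _).union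
      ((List.finite_toSet ρ.neg).biUnion fun a _ => Term.finite_consts _))).subset this

theorem Program.stage_subset {P : Program τ τ' ar} {d : Set U} (hP : P.consts ⊆ d)
    (D : Instance τ) (j : ℕ) : ∀ f ∈ P.stage d D j, ∀ i, f.2 i ∈ d := by
  induction j with
  | zero => exact fun f hf => hf.elim
  | succ j ih =>
    rintro f (hf | ⟨ρ, hρ, v, hv, -, -, rfl⟩) i
    · exact ih f hf i
    · change (ρ.head.args i).eval v ∈ d
      cases h : ρ.head.args i with
      | var x => exact hv x
      | const c => exact hP ⟨ρ, hρ, Or.inl ⟨i, h⟩⟩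

theorem Atom.Holds.mem {D : Instance τ} {J : IdbState τ' ar} {d : Set U} (hD : ↑(adom D) ⊆ d)
    (hJ : ∀ f ∈ J, ∀ i, f.2 i ∈ d) {n : ℕ} {v : Fin n → U} {a : Atom U (bodyArity τ τ' ar) n}
    (h : a.Holds D J v) (i) : (a.args i).eval v ∈ d := by
  obtain ⟨r | p, s⟩ := a
  · exact hD (mem_adom.2 ⟨r, _, h, i, rfl⟩)
  · exact hJ _ h i

theorem Atom.Holds.congr {D : Instance τ} {J : IdbState τ' ar} {n : ℕ} {v w : Fin n → U}
    {a : Atom U (bodyArity τ τ' ar) n} (h : a.Holds D J v)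
    (hvw : ∀ i, (a.args i).eval v = (a.args i).eval w) : a.Holds D J w := by
  obtain ⟨r | p, s⟩ := a
  · have e : (fun i => (s i).eval v) = fun i => (s i).eval w := funext hvw
    simp only [Atom.Holds] at h ⊢
    rwa [← e]
  · have e : (fun i => (s i).eval v) = fun i => (s i).eval w := funext hvw
    exact (congrArg (fun x => (⟨p, x⟩ : Σ q, (Fin (idbArity τ' ar q) → U)) ∈ J) e).mp h

/-- A Datalog program generates the same facts if the variables range over any set that contains
the values of the instance and the constants of the program. -/
theorem Program.IsDatalog.stage_eq {P : Program τ τ' ar} (hP : P.IsDatalog) {D : Instance τ}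
    {d : Set U} (hD : ↑(adom D) ⊆ d) (hc : P.consts ⊆ d) (hne : U → d.Nonempty) (j : ℕ) :
    P.stage Set.univ D j = P.stage d D j := by
  classical
  induction j with
  | zero => rfl
  | succ j ih =>
    have hJ := Program.stage_subset hc D j
    simp only [Program.stage, ih]
    congr 1
    ext f
    constructor
    · rintro ⟨ρ, hρ, v, -, hpos, -, rfl⟩
      let w : Fin ρ.n → U := fun i => if v i ∈ d then v i else (hne (v i)).some
      have hw : ∀ i, v i ∈ d → w i = v i := fun i hi => if_pos hi
      refine ⟨ρ, hρ, w, fun i => ?_, fun a ha => ?_, by simp [(hP ρ hρ).1], ?_⟩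
      · by_cases h : v i ∈ d
        · rwa [hw i h]
        · simp only [w, if_neg h]
          exact (hne (v i)).some_mem
      · refine (hpos a ha).congr fun i => ?_
        have hm := (hpos a ha).mem hD hJ i
        cases h : a.args i with
        | var x =>
          rw [h] at hm
          exact (hw x hm).symm
        | const c => rfl
      · congr 1
        funext i
        cases h : ρ.head.args i with
        | var x =>
          obtain ⟨a, ha, i', hi'⟩ := (hP ρ hρ).2 x ⟨i, h⟩
          have hm := (hpos a ha).mem hD hJ i'
          rw [hi'] at hm
          exact (hw x hm).symm
        | const c => rfl
    · rintro ⟨ρ, hρ, v, -, h⟩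
      exact ⟨ρ, hρ, v, fun i => trivial, h⟩

variable [StandardBorelSpace U] {Ω : Type*} [MeasurableSpace Ω]

theorem Atom.measurableSet_holds {D : Ω → Instance τ} (hD : Measurable D)
    {J : Ω → IdbState τ' ar}
    (hJ : ∀ s, MeasurableSet {p : Ω × (Fin (idbArity τ' ar s) → U) |
      (⟨s, p.2⟩ : Σ q, (Fin (idbArity τ' ar q) → U)) ∈ J p.1}) {n : ℕ}
    (a : Atom U (bodyArity τ τ' ar) n) :
    MeasurableSet {p : Ω × (Fin n → U) | a.Holds (D p.1) (J p.1) p.2} := by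
  obtain ⟨r | s, t⟩ := a
  · exact ((measurable_relOf r).comp (hD.comp measurable_fst)).bag_mem
      (measurable_pi_lambda _ fun i => (t i).measurable_eval.comp measurable_snd)
  · exact (measurable_fst.prodMk
      (measurable_pi_lambda _ fun i => (t i).measurable_eval.comp measurable_snd)) (hJ s)

theorem Program.measurableSet_stage (P : Program τ τ' ar) {D : Ω → Instance τ}
    (hD : Measurable D) {d : Ω → Finset U} (hd : Measurable fun ω => (d ω).val) (j : ℕ) :
    ∀ s, MeasurableSet {p : Ω × (Fin (idbArity τ' ar s) → U) |
      (⟨s, p.2⟩ : Σ q, (Fin (idbArity τ' ar q) → U)) ∈ P.stage ↑(d p.1) (D p.1) j} := by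
  induction j with
  | zero => exact fun s => MeasurableSet.empty
  | succ j ih =>
    intro s
    suffices h : MeasurableSet {p : Ω × (Fin (idbArity τ' ar s) → U) |
        (⟨s, p.2⟩ : Σ q, (Fin (idbArity τ' ar q) → U)) ∈
          P.consequences ↑(d p.1) (D p.1) (P.stage ↑(d p.1) (D p.1) j)} from (ih s).union h
    have e : {p : Ω × (Fin (idbArity τ' ar s) → U) |
        (⟨s, p.2⟩ : Σ q, (Fin (idbArity τ' ar q) → U)) ∈
          P.consequences ↑(d p.1) (D p.1) (P.stage ↑(d p.1) (D p.1) j)} =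
        ⋃ ρ ∈ {ρ | ρ ∈ P}, {p | ∃ v ∈ (Fintype.piFinset fun _ : Fin ρ.n => d p.1).val,
          v ∈ {v | (∀ a ∈ {a | a ∈ ρ.pos}, a.Holds (D p.1) (P.stage ↑(d p.1) (D p.1) j) v) ∧
            (∀ a ∈ {a | a ∈ ρ.neg}, ¬ a.Holds (D p.1) (P.stage ↑(d p.1) (D p.1) j) v) ∧
            (⟨s, p.2⟩ : Σ q, (Fin (idbArity τ' ar q) → U)) =
              ⟨ρ.head.sym, fun i => (ρ.head.args i).eval v⟩}} := by
      ext p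
      simp [Program.consequences]
    rw [e]
    refine MeasurableSet.biUnion (List.finite_toSet P).countable fun ρ _ => ?_
    refine ((hd.comp measurable_fst).bag_piFinset ρ.n).bag_exists ?_
    have hpull : Measurable fun q : (Ω × (Fin (idbArity τ' ar s) → U)) × (Fin ρ.n → U) =>
        (q.1.1, q.2) := measurable_fst.fst.prodMk measurable_snd
    have hatom : ∀ a : Atom U (bodyArity τ τ' ar) ρ.n, MeasurableSet
        {q : (Ω × (Fin (idbArity τ' ar s) → U)) × (Fin ρ.n → U) |
          a.Holds (D q.1.1) (P.stage ↑(d q.1.1) (D q.1.1) j) q.2} :=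
      fun a => hpull (a.measurableSet_holds hD
        (J := fun ω => P.stage ↑(d ω) (D ω) j) ih)
    refine MeasurableSet.inter ?_ (MeasurableSet.inter ?_ ?_)
    · change MeasurableSet {q | _}
      simp only [Set.ofPred_forall]
      exact MeasurableSet.biInter (List.finite_toSet ρ.pos).countable fun a _ => hatom a
    · change MeasurableSet {q | _}
      simp only [Set.ofPred_forall]
      exact MeasurableSet.biInter (List.finite_toSet ρ.neg).countable fun a _ => (hatom a).compl
    · obtain ⟨n, ⟨s', t⟩, pos, neg⟩ := ρ
      change MeasurableSet {q : (Ω × (Fin (idbArity τ' ar s) → U)) × (Fin n → U) |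
        (⟨s, q.1.2⟩ : Σ q, (Fin (idbArity τ' ar q) → U)) = ⟨s', fun i => (t i).eval q.2⟩}
      by_cases h : s = s'
      · subst h
        convert measurableSet_eq_fun (f := fun q : (Ω × (Fin (idbArity τ' ar s) → U)) × (Fin n → U)
          => q.1.2) (g := fun q i => (t i).eval q.2) measurable_fst.snd
          (measurable_pi_lambda _ fun i => (t i).measurable_eval.comp measurable_snd) using 1
        ext q
        simp
      · convert MeasurableSet.empty
        ext q
        simp [h]

theorem Program.measurableSet_answers (P : Program τ τ' ar) {D : Ω → Instance τ}
    (hD : Measurable D) {d : Ω → Finset U} (hd : Measurable fun ω => (d ω).val) (r : τ'.Rel) :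
    MeasurableSet {p : Ω × (Fin (τ'.arity r) → U) | p.2 ∈ P.answers ↑(d p.1) (D p.1) r} := by
  have e : {p : Ω × (Fin (τ'.arity r) → U) | p.2 ∈ P.answers ↑(d p.1) (D p.1) r} =
      ⋃ j, {p | (⟨Sum.inl r, p.2⟩ : Σ q, (Fin (idbArity τ' ar q) → U)) ∈
        P.stage ↑(d p.1) (D p.1) j} := by
    ext p
    simp [Program.answers]
  rw [e]
  exact MeasurableSet.iUnion fun j => P.measurableSet_stage hD hd j (Sum.inl r)

theorem DatalogExpressible.measurable {V : View τ τ'} (h : DatalogExpressible V) :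
    Measurable V := by
  classical
  obtain ⟨A, -, ar, P, hP, hV⟩ := h
  obtain ⟨S, hS⟩ : ∃ S : Finset U, U → S.Nonempty := by
    rcases isEmpty_or_nonempty U with h | ⟨⟨u⟩⟩
    · exact ⟨∅, fun u => h.elim u⟩
    · exact ⟨{u}, fun _ => ⟨u, by simp⟩⟩
  let d : Instance τ → Finset U := fun D => adom D ∪ (P.finite_consts.toFinset ∪ S)
  have hd : Measurable fun D => (d D).val := measurable_adom.finset_union measurable_const
  have had : ∀ D, (↑(adom D) : Set U) ⊆ ↑(d D) := fun D =>
    Finset.coe_subset.2 Finset.subset_union_left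
  have hc : ∀ D, P.consts ⊆ ↑(d D) := fun D c hc => by
    simp [d, hc]
  have hans : ∀ D r, P.answers Set.univ D r = P.answers ↑(d D) D r := by
    intro D r
    have hst := hP.stage_eq (had D) (hc D) fun u =>
      (hS u).mono fun x hx => by simp [d, Finset.mem_coe.1 hx]
    simp only [Program.answers, hst]
  simp only [hans] at hV
  exact hV.measurable hd (fun r => P.measurableSet_answers measurable_id hd r)
    fun D r t ⟨j, hj⟩ i => Program.stage_subset (hc D) D j _ hj i

theorem InflationaryDatalogExpressible.measurable {V : View τ τ'}
    (h : InflationaryDatalogExpressible V) : Measurable V := by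
  classical
  obtain ⟨A, -, ar, P, hV⟩ := h
  let d : Instance τ → Finset U := fun D => adom D ∪ P.finite_consts.toFinset
  have hd : Measurable fun D => (d D).val := measurable_adom.finset_union measurable_const
  have hcoe : ∀ D, ((↑(adom D) : Set U) ∪ P.consts) = ↑(d D) := fun D => by simp [d]
  simp only [hcoe] at hV
  exact hV.measurable hd (fun r => P.measurableSet_answers measurable_id hd r)
    fun D r t ⟨j, hj⟩ i =>
      Program.stage_subset (hcoe D ▸ Set.subset_union_right) D j _ hj i

end DatalogMeasurability

/-! ### Least fixed-point logic -/

section FixedPointMeasurability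

/-- The least pre-fixed point of a monotone operator with values in the subsets of a finite set is
the union of its finite iterates on the empty set. -/
theorem sInter_closed_eq_iUnion_iterate {α : Type*} {F : Set α → Set α} (hF : Monotone F)
    {K : Set α} (hK : K.Finite) (hFK : ∀ S, F S ⊆ K) :
    ⋂₀ {S | F S ⊆ S} = ⋃ j, F^[j] ∅ := by
  apply Set.Subset.antisymm
  · refine Set.sInter_subset_of_mem ?_
    have hmono : Monotone fun j => F^[j] ∅ :=
      hF.monotone_iterate_of_le_map (Set.empty_subset _)
    have hsub : ⋃ j, F^[j] ∅ ⊆ K := by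
      refine Set.iUnion_subset fun j => ?_
      cases j with
      | zero => exact Set.empty_subset _
      | succ j =>
        rw [Function.iterate_succ_apply']
        exact hFK _
    have hfin := hK.subset hsub
    choose! j hj using fun x (hx : x ∈ ⋃ j, F^[j] ∅) => Set.mem_iUnion.1 hx
    have hN : ⋃ j, F^[j] ∅ ⊆ F^[hfin.toFinset.sup j] ∅ := fun x hx =>
      hmono (Finset.le_sup (f := j) (hfin.mem_toFinset.2 hx)) (hj x hx)
    refine (hF hN).trans ?_
    rw [← Function.iterate_succ_apply' F]
    exact Set.subset_iUnion (fun j => F^[j] ∅) _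
  · refine Set.iUnion_subset fun j => Set.subset_sInter fun S hS => ?_
    induction j with
    | zero => exact Set.empty_subset _
    | succ j ih =>
      rw [Function.iterate_succ_apply']
      exact (hF ih).trans hS

variable {U : Type u} [MeasurableSpace U] {τ : Schema U}

theorem LFPFormula.finite_consts {s : ℕ} {Γ : Fin s → ℕ} {n : ℕ} (φ : LFPFormula τ Γ n) :
    φ.consts.Finite := by
  induction φ with
  | rel r t => exact Term.finite_consts t
  | rvar X t => exact Term.finite_consts t
  | eq t₁ t₂ =>
    refine (Term.finite_consts ![t₁, t₂]).subset ?_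
    rintro c (h | h)
    · exact ⟨0, h⟩
    · exact ⟨1, h⟩
  | pred B hB t => exact Term.finite_consts t
  | not φ ih => exact ih
  | and φ ψ ih₁ ih₂ => exact ih₁.union ih₂
  | or φ ψ ih₁ ih₂ => exact ih₁.union ih₂
  | ex φ ih => exact ih
  | all φ ih => exact ih
  | lfp k φ t ih => exact ih.union (Term.finite_consts t)

/-- Truth is monotone in positive and antitone in negative relation variables. -/
theorem LFPFormula.Polarity.sat_mono {D : Instance τ} {d : Set U} {s : ℕ} {Γ : Fin s → ℕ} {n : ℕ}
    {φ : LFPFormula τ Γ n} {X : Fin s} {ρ σ : (X : Fin s) → Set (Fin (Γ X) → U)}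
    (hX : ρ X ⊆ σ X) (hne : ∀ Y, Y ≠ X → ρ Y = σ Y) {b : Bool} (h : φ.Polarity b X)
    (v : Fin n → U) :
    (b = true → φ.Sat D d ρ v → φ.Sat D d σ v) ∧ (b = false → φ.Sat D d σ v → φ.Sat D d ρ v) := by
  induction φ generalizing b with
  | rel r t => exact ⟨fun _ h => h, fun _ h => h⟩
  | rvar Y t =>
    by_cases hY : Y = X
    · subst hY
      refine ⟨fun _ hs => hX hs, fun hb => ?_⟩
      rw [h rfl] at hb
      cases hb
    · simp only [LFPFormula.Sat, hne Y hY]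
      exact ⟨fun _ h => h, fun _ h => h⟩
  | eq t₁ t₂ => exact ⟨fun _ h => h, fun _ h => h⟩
  | pred B hB t => exact ⟨fun _ h => h, fun _ h => h⟩
  | not φ ih =>
    have := ih hX hne (b := !b) h v
    exact ⟨fun hb hs hn => hs (this.2 (by simp [hb]) hn),
      fun hb hs hn => hs (this.1 (by simp [hb]) hn)⟩
  | and φ ψ ih₁ ih₂ =>
    have h₁ := ih₁ hX hne h.1 v
    have h₂ := ih₂ hX hne h.2 v
    exact ⟨fun hb => And.imp (h₁.1 hb) (h₂.1 hb), fun hb => And.imp (h₁.2 hb) (h₂.2 hb)⟩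
  | or φ ψ ih₁ ih₂ =>
    have h₁ := ih₁ hX hne h.1 v
    have h₂ := ih₂ hX hne h.2 v
    exact ⟨fun hb => Or.imp (h₁.1 hb) (h₂.1 hb), fun hb => Or.imp (h₁.2 hb) (h₂.2 hb)⟩
  | ex φ ih =>
    exact ⟨fun hb ⟨a, ha, hs⟩ => ⟨a, ha, (ih hX hne h _).1 hb hs⟩,
      fun hb ⟨a, ha, hs⟩ => ⟨a, ha, (ih hX hne h _).2 hb hs⟩⟩
  | all φ ih =>
    exact ⟨fun hb hs a ha => (ih hX hne h _).1 hb (hs a ha),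
      fun hb hs a ha => (ih hX hne h _).2 hb (hs a ha)⟩
  | @lfp s Γ n k φ t ih =>
    have key := fun (S : Set (Fin k → U)) => ih (X := X.succ)
      (ρ := Fin.cons (α := fun X => Set (Fin ((Fin.cons k Γ : Fin (s + 1) → ℕ) X) → U)) S ρ)
      (σ := Fin.cons (α := fun X => Set (Fin ((Fin.cons k Γ : Fin (s + 1) → ℕ) X) → U)) S σ)
      hX (fun Y => Fin.cases (fun _ => rfl)
        (fun Y hY => hne Y fun e => hY (congrArg Fin.succ e)) Y) h
    exact ⟨fun hb hs S hS => hs S fun a ha hsat => hS a ha ((key S _).1 hb hsat),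
      fun hb hs S hS => hs S fun a ha hsat => hS a ha ((key S _).2 hb hsat)⟩

variable [StandardBorelSpace U]

theorem LFPFormula.measurableSet_sat {s : ℕ} {Γ : Fin s → ℕ} {n : ℕ} (φ : LFPFormula τ Γ n)
    (hφ : φ.WellFormed) {Ω : Type u} [MeasurableSpace Ω] {D : Ω → Instance τ} (hD : Measurable D)
    {d : Ω → Finset U} (hd : Measurable fun ω => (d ω).val)
    {ρ : Ω → (X : Fin s) → Set (Fin (Γ X) → U)}
    (hρ : ∀ X, MeasurableSet {p : Ω × (Fin (Γ X) → U) | p.2 ∈ ρ p.1 X}) :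
    MeasurableSet {p : Ω × (Fin n → U) | φ.Sat (D p.1) ↑(d p.1) (ρ p.1) p.2} := by
  induction φ generalizing Ω with
  | rel r t =>
    exact ((measurable_relOf r).comp (hD.comp measurable_fst)).bag_mem
      (measurable_pi_lambda _ fun i => (t i).measurable_eval.comp measurable_snd)
  | rvar X t =>
    exact (measurable_fst.prodMk
      (measurable_pi_lambda _ fun i => (t i).measurable_eval.comp measurable_snd)) (hρ X)
  | eq t₁ t₂ =>
    exact measurableSet_eq_fun (t₁.measurable_eval.comp measurable_snd)
      (t₂.measurable_eval.comp measurable_snd)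
  | pred B hB t =>
    exact (measurable_pi_lambda _ fun i => (t i).measurable_eval.comp measurable_snd) hB
  | not φ ih => exact (ih hφ hD hd hρ).compl
  | and φ ψ ih₁ ih₂ => exact (ih₁ hφ.1 hD hd hρ).inter (ih₂ hφ.2 hD hd hρ)
  | or φ ψ ih₁ ih₂ => exact (ih₁ hφ.1 hD hd hρ).union (ih₂ hφ.2 hD hd hρ)
  | @ex s Γ n φ ih =>
    exact (hd.comp measurable_fst).bag_exists (S := fun p : Ω × (Fin n → U) =>
      {a | φ.Sat (D p.1) ↑(d p.1) (ρ p.1) (Fin.snoc (α := fun _ => U) p.2 a : Fin (n + 1) → U)})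
      ((measurable_fst.fst.prodMk
        (measurable_finSnoc.comp (measurable_fst.snd.prodMk measurable_snd)))
        (ih hφ hD hd hρ))
  | @all s Γ n φ ih =>
    exact (hd.comp measurable_fst).bag_forall (S := fun p : Ω × (Fin n → U) =>
      {a | φ.Sat (D p.1) ↑(d p.1) (ρ p.1) (Fin.snoc (α := fun _ => U) p.2 a : Fin (n + 1) → U)})
      ((measurable_fst.fst.prodMk
        (measurable_finSnoc.comp (measurable_fst.snd.prodMk measurable_snd)))
        (ih hφ hD hd hρ))
  | @lfp s Γ n k φ t ih =>
    let ext : Set (Fin k → U) → Ω →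
        (X : Fin (s + 1)) → Set (Fin ((Fin.cons k Γ : Fin (s + 1) → ℕ) X) → U) := fun S ω =>
      Fin.cons (α := fun X => Set (Fin ((Fin.cons k Γ : Fin (s + 1) → ℕ) X) → U)) S (ρ ω)
    let F : Ω × (Fin n → U) → Set (Fin k → U) → Set (Fin k → U) := fun p S =>
      {a | (∀ i, a i ∈ d p.1) ∧ φ.Sat (D p.1) ↑(d p.1) (ext S p.1) (Fin.append p.2 a)}
    have hmono : ∀ p, Monotone (F p) := fun p S T hST a ha =>
      ⟨ha.1, (hφ.2.sat_mono (X := 0) (ρ := ext S p.1) (σ := ext T p.1) hST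
        (fun Y => Fin.cases (fun h => (h rfl).elim) (fun Y _ => rfl) Y) _).1 rfl ha.2⟩
    have hfix : ∀ p, ⋂₀ {S | F p S ⊆ S} = ⋃ j, (F p)^[j] ∅ := fun p =>
      sInter_closed_eq_iUnion_iterate (hmono p)
        (Fintype.piFinset fun _ : Fin k => d p.1).finite_toSet
        fun S a ha => by simpa using ha.1
    have hstage : ∀ j, MeasurableSet
        {q : (Ω × (Fin n → U)) × (Fin k → U) | q.2 ∈ (F q.1)^[j] ∅} := by
      intro j
      induction j with
      | zero => exact MeasurableSet.empty
      | succ j hj =>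
        simp only [Function.iterate_succ_apply']
        refine MeasurableSet.inter ?_ ?_
        · change MeasurableSet {q : (Ω × (Fin n → U)) × (Fin k → U) | ∀ i, q.2 i ∈ d q.1.1}
          simp only [Set.ofPred_forall]
          exact MeasurableSet.iInter fun i =>
            (hd.comp measurable_fst.fst).bag_mem measurable_snd.eval
        · have h := ih hφ.1 (Ω := Ω × (Fin n → U)) (hD.comp measurable_fst)
            (d := fun p => d p.1) (hd.comp measurable_fst)
            (ρ := fun p => ext ((F p)^[j] ∅) p.1)
            (fun X => Fin.cases hj (fun X => (measurable_fst.fst.prodMk measurable_snd) (hρ X)) X)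
          exact (measurable_fst.prodMk (measurable_finAppend.comp
            (measurable_fst.snd.prodMk measurable_snd))) h
    have e : {p : Ω × (Fin n → U) | (LFPFormula.lfp k φ t).Sat (D p.1) ↑(d p.1) (ρ p.1) p.2} =
        ⋃ j, {p | (fun i => (t i).eval p.2) ∈ (F p)^[j] ∅} := by
      ext p
      have h := hfix p
      have hset : {S | F p S ⊆ S} = {S : Set (Fin k → U) | ∀ a : Fin k → U,
          (∀ i, a i ∈ (↑(d p.1) : Set U)) →
            φ.Sat (D p.1) ↑(d p.1) (ext S p.1) (Fin.append p.2 a) → a ∈ S} := by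
        ext S
        exact ⟨fun h a ha hs => h ⟨ha, hs⟩, fun h a ha => h a ha.1 ha.2⟩
      rw [hset] at h
      have h' := Set.ext_iff.1 h fun i => (t i).eval p.2
      simp only [Set.mem_iUnion] at h' ⊢
      exact h'
    rw [e]
    exact MeasurableSet.iUnion fun j => (measurable_id.prodMk
      (measurable_pi_lambda _ fun i => (t i).measurable_eval.comp measurable_snd)) (hstage j)

theorem LFPExpressible.measurable {τ' : Schema U} {V : View τ τ'} (h : LFPExpressible V) :
    Measurable V := by
  classical
  obtain ⟨φ, hφ, hV⟩ := h
  have := τ'.finite_rel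
  have := Fintype.ofFinite τ'.Rel
  let d : τ'.Rel → Instance τ → Finset U := fun r D => adom D ∪ (φ r).finite_consts.toFinset
  have hd : ∀ r, Measurable fun D => (d r D).val := fun r =>
    measurable_adom.finset_union measurable_const
  refine measurable_of_relOf fun r => ?_
  have hcoe : ∀ D, ((↑(adom D) : Set U) ∪ (φ r).consts) = ↑(d r D) := fun D => by simp [d]
  have hans : ∀ D t, t ∈ relOf (V D) r ↔
      (∀ i, t i ∈ d r D) ∧ (φ r).Sat D ↑(d r D) (fun X => X.elim0) t := by
    intro D t
    rw [(hV D r).2]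
    simp only [LFPFormula.answers, hcoe]
    rfl
  refine measurable_bag_of_mem ((hd r).bag_piFinset (τ'.arity r)) (fun D => (hV D r).1) ?_ ?_
  · simp only [hans]
    refine MeasurableSet.inter ?_ ((φ r).measurableSet_sat (hφ r)
      (D := fun D : Instance τ => D) measurable_id (hd r) (ρ := fun _ X => X.elim0)
      fun X => X.elim0)
    change MeasurableSet {q : Instance τ × (Fin (τ'.arity r) → U) | ∀ i, q.2 i ∈ d r q.1}
    simp only [Set.ofPred_forall]
    exact MeasurableSet.iInter fun i => ((hd r).comp measurable_fst).bag_mem measurable_snd.eval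
  · intro D t ht
    simpa using ((hans D t).1 ht).1

end FixedPointMeasurability

end StandardPDB

theorem theorem1 {U : Type*} [TopologicalSpace U] [PolishSpace U] [MeasurableSpace U]
    [BorelSpace U] (τ τ' : StandardPDB.Schema U) (V : StandardPDB.View τ τ')
    (hV : StandardPDB.AlgebraExpressible V ∨ StandardPDB.CalculusExpressible V ∨
      StandardPDB.DatalogExpressible V ∨ StandardPDB.InflationaryDatalogExpressible V ∨
      StandardPDB.LFPExpressible V) :
    Measurable V ∧
      ∀ P : StandardPDB.PDB τ, ∃! P' : StandardPDB.PDB τ',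
        ∀ C' : Set (StandardPDB.Instance τ'), MeasurableSet C' →
          (P' : MeasureTheory.Measure (StandardPDB.Instance τ')) C' =
            (P : MeasureTheory.Measure (StandardPDB.Instance τ)) (V ⁻¹' C') := by
  have hm : Measurable V := by
    rcases hV with h | h | h | h | h
    · exact h.measurable
    · exact h.measurable
    · exact h.measurable
    · exact h.measurable
    · exact h.measurable
  refine ⟨hm, fun P => ⟨P.map hm.aemeasurable, fun C' hC' => ?_, fun Q hQ => ?_⟩⟩
  · exact Measure.map_apply hm hC'
  · refine Subtype.ext (Measure.ext fun C' hC' => ?_)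
    exact (hQ C' hC').trans (Measure.map_apply hm hC').symm
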